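/- A \emph{twisted link diagram} is a generically immersed collection of oriented loops in the plane whose double points are positive, negative or virtual crossings, possibly with bars on its arcs. Two diagrams represent the same \emph{twisted link} if they are related by a finite sequence of planar isotopies, Reidemeister moves I--III, virtual Reidemeister moves I--IV (a virtual curl is removed; a virtual bigon is removed; a strand with two virtual crossings is moved over a virtual crossing; a strand with two virtual crossings is moved over a real crossing) and twisted Reidemeister moves I--III (a bar is moved past a virtual crossing; two neighbouring bars on an arc cancel; a real crossing with a bar on each of its four arcs is replaced by a vertical stack virtual crossing -- real crossing -- virtual crossing without bars, where the real crossing has the same sign). Let $D$ be a twisted link diagram with real crossings $c_1,\dots,c_n$. Let $|D|$ be the 4-valent graph with vertices $c_1,\dots,c_n$ obtained from $D$ by ignoring virtual crossings; its edges may carry bars. Seen with both strands at $c_i$ running upwards, denote the incoming ends of edges at $c_i$ by $i_0^-$ (left), $i_1^-$ (right) and the outgoing ends by $i_0^+$ (left), $i_1^+$ (right). Write $i_\epsilon\overset{\mathrm e}{\leftarrow}j_\lambda$ (resp. $i_\epsilon\overset{\mathrm o}{\leftarrow}j_\lambda$) if $i_\epsilon^-$ and $j_\lambda^+$ are on the same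 edge of $|D|$ and this edge carries an even (resp. odd) number of bars, $\epsilon,\lambda\in\{0,1\}$; both relations are declared false if $\epsilon$ or $\lambda$ is $2$ or $3$. Put $$M_+=\begin{pmatrix}1-x&-y\\-xy^{-1}&0\end{pmatrix},\qquad M_-=\begin{pmatrix}0&-x^{-1}y\\-y^{-1}&1-x^{-1}\end{pmatrix},$$ and let $\widetilde M=\mathrm{diag}(\widetilde M_1,\dots,\widetilde M_n)$, where $\widetilde M_i=\mathrm{diag}(M_+,M_+)$ if $c_i$ is positive and $\widetilde M_i=\mathrm{diag}(M_-,M_-)$ if $c_i$ is negative. Let $\widetilde P=(\tilde p_{kl})$ be the $4n\times4n$ matrix such that, for $i,j\in\{1,\dots,n\}$ and $a,b\in\{0,1,2,3\}$, $\tilde p_{(4i-3+a)(4j-3+b)}=1$ if $$i_a\overset{\mathrm e}{\leftarrow}j_b\ \text{ or }\ i_{3-a}\overset{\mathrm e}{\leftarrow}j_{3-b}\ \text{ or }\ i_a\overset{\mathrm o}{\leftarrow}j_{3-b}\ \text{ or }\ i_{3-a}\overset{\mathrm o}{\leftarrow}j_b,$$ and $\tilde p_{(4i-3+a)(4j-3+b)}=0$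 otherwise. Let $\widetilde Z_D(x,y)=\det(\widetilde M-\widetilde P)\in\mathbb Z[x^{\pm1},y^{\pm1}]$. \textbf{Theorem.} Let $D$ and $D'$ be twisted link diagrams that represent the same twisted link, and suppose that in each of $D$ and $D'$ every loop passes through at least one real crossing. Then $\widetilde Z_{D'}(x,y)=x^m\,\widetilde Z_D(x,y)$ for some $m\in\mathbb Z$. (The diagrams in between, in a sequence of moves from $D$ to $D'$, are not restricted.) -/

import Mathlib

namespace TwistedLink

/-!
## Twisted link diagrams

A generically immersed collection of oriented loops in the plane, with real crossings, virtual
crossings and bars, is encoded by its combinatorial planar map.  The vertices are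

* the crossings `Fin m` (real or virtual), which are 4-valent, and
* finitely many points `Fin n` on the arcs, which are 2-valent; such a point either carries a bar
  or is a plain point of the arc (plain points may be inserted and removed freely; they make it
  possible to have loops without crossings and bars).

A *dart* is a vertex together with one of the ends of arcs at this vertex.  The darts at a vertex
are numbered counterclockwise.  At a real crossing the darts `0, 2` form the over-strand and the
darts `1, 3` the under-strand.
-/

/-- Darts at 4-valent vertices `X` and at 2-valent vertices `J`. -/
abbrev Dart (X J : Type) : Type := (X × Fin 4) ⊕ (J × Fin 2)

/-- The next dart, in counterclockwise order, at the same vertex. -/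
def ccw {X J : Type} : Dart X J → Dart X J
  | Sum.inl (c, i) => Sum.inl (c, i + 1)
  | Sum.inr (p, i) => Sum.inr (p, i + 1)

/-- The opposite dart at the same vertex: where a strand arriving at the vertex goes on. -/
def opp {X J : Type} : Dart X J → Dart X J
  | Sum.inl (c, i) => Sum.inl (c, i + 2)
  | Sum.inr (p, i) => Sum.inr (p, i + 1)

/-- Being on the over-strand of a crossing (meaningful for real crossings only). -/
def isOver {X J : Type} : Dart X J → Bool
  | Sum.inl (_, i) => i = 0 ∨ i = 2
  | Sum.inr _ => false

/-- An (oriented) twisted link diagram. -/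
structure Diagram where
  /-- number of crossings, real and virtual -/
  m : ℕ
  /-- number of bars and plain points -/
  n : ℕ
  /-- `true` for a real crossing, `false` for a virtual crossing -/
  real : Fin m → Bool
  /-- `true` for a bar, `false` for a plain point -/
  bar : Fin n → Bool
  /-- the other end of the arc that starts with a given dart -/
  link : Dart (Fin m) (Fin n) → Dart (Fin m) (Fin n)
  /-- `true` if the orientation of the strand points away from the vertex along the dart -/
  out : Dart (Fin m) (Fin n) → Bool
  link_link : ∀ d, link (link d) = d
  out_link : ∀ d, out (link d) = !out d
  out_opp : ∀ d, out (opp d) = !out d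
  /-- Planarity: `V - E + F = 2 C` for the numbers of vertices, edges, faces and connected
  components of the map, multiplied by `2` and without subtraction. -/
  planar :
    2 * (m + n) + 2 * Nat.card (Quot fun d e => e = ccw (link d)) =
      Nat.card (Dart (Fin m) (Fin n)) + 4 * Nat.card (Quot fun d e => e = ccw d ∨ e = link d)

namespace Diagram

variable (D : Diagram)

/-- Being a dart at a real crossing. -/
def atReal : Dart (Fin D.m) (Fin D.n) → Bool
  | Sum.inl (c, _) => D.real c
  | Sum.inr _ => false

/-- Being a dart at a bar. -/
def atBar : Dart (Fin D.m) (Fin D.n) → Bool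
  | Sum.inl _ => false
  | Sum.inr (p, _) => D.bar p

/-- `D.Path d e k`: leaving a vertex along the dart `d` and going straight through virtual
crossings, bars and plain points only, one arrives at a vertex through the dart `e`, after having
passed `k` bars.  If `d` and `e` are darts at real crossings, this says that `d` and `e` are the
two ends of one edge of the graph `|D|` whose vertices are the real crossings, and that there are
`k` bars on this edge. -/
inductive Path (d : Dart (Fin D.m) (Fin D.n)) : Dart (Fin D.m) (Fin D.n) → ℕ → Prop
  | start : Path d (D.link d) 0
  | pass {e : Dart (Fin D.m) (Fin D.n)} {k : ℕ} (h : Path d e k) (he : D.atReal e = false) :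
      Path d (D.link (opp e)) (k + if D.atBar e then 1 else 0)

/-- Every loop of the diagram passes through at least one real crossing, i.e. `|D|` is a graph
without circle components that are free of vertices. -/
def NoFreeCircle : Prop := ∀ d, ∃ e k, D.Path d e k ∧ D.atReal e = true

/-- The real crossings. -/
abbrev RealCrossing : Type := {c : Fin D.m // D.real c = true}

/-- The left-right label of the short edge given by a dart at a crossing, seen in the direction
of the strands: if both strands run upwards, the four darts are, counterclockwise from the upper
right, outgoing-right, outgoing-left, incoming-left and incoming-right.  The left ones have
label `0`, the right ones label `1`. -/
def label (d : Dart (Fin D.m) (Fin D.n)) : Fin 4 := if D.out (ccw d) then 1 else 0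

/-- A crossing is positive if its over-strand runs from the lower left to the upper right when
both strands run upwards, i.e. if its outgoing-right dart is on the over-strand. -/
def IsPositive (c : Fin D.m) : Prop :=
  ∃ i : Fin 4, D.out (Sum.inl (c, i)) = true ∧ D.out (ccw (Sum.inl (c, i))) = true ∧
    isOver (Sum.inl (c, i) : Dart (Fin D.m) (Fin D.n)) = true

/-- The short edges `i_a^-` (incoming at `i`, label `a`) and `j_b^+` (outgoing at `j`,
label `b`) are on the same edge of `|D|`, with `k` bars on it.  It is false unless `a` and `b`
are `0` or `1`. -/
def ArrowWith (k : ℕ) (i : D.RealCrossing) (a : Fin 4) (j : D.RealCrossing) (b : Fin 4) : Prop :=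
  ∃ s t : Fin 4,
    D.out (Sum.inl (i.1, s)) = false ∧ D.label (Sum.inl (i.1, s)) = a ∧
    D.out (Sum.inl (j.1, t)) = true ∧ D.label (Sum.inl (j.1, t)) = b ∧
    D.Path (Sum.inl (j.1, t)) (Sum.inl (i.1, s)) k

/-- `i_a ← j_b` with an even number of bars. -/
def EvenArrow (i : D.RealCrossing) (a : Fin 4) (j : D.RealCrossing) (b : Fin 4) : Prop :=
  ∃ k, Even k ∧ D.ArrowWith k i a j b

/-- `i_a ← j_b` with an odd number of bars. -/
def OddArrow (i : D.RealCrossing) (a : Fin 4) (j : D.RealCrossing) (b : Fin 4) : Prop :=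
  ∃ k, Odd k ∧ D.ArrowWith k i a j b

end Diagram

/-! ## The polynomial -/

/-- Laurent polynomials in `x` and `y` over the integers: the inner variable is `x`, the outer
variable is `y`. -/
abbrev LaurentXY : Type := LaurentPolynomial (LaurentPolynomial ℤ)

/-- The power `x ^ k`. -/
noncomputable def xPow (k : ℤ) : LaurentXY := LaurentPolynomial.C (LaurentPolynomial.T k)

/-- The power `y ^ k`. -/
noncomputable def yPow (k : ℤ) : LaurentXY := LaurentPolynomial.T k

/-- The block of a positive crossing. -/
noncomputable def blockPos : Matrix (Fin 4) (Fin 4) LaurentXY :=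
  !![1 - xPow 1, -yPow 1, 0, 0;
     -(xPow 1 * yPow (-1)), 0, 0, 0;
     0, 0, 1 - xPow 1, -yPow 1;
     0, 0, -(xPow 1 * yPow (-1)), 0]

/-- The block of a negative crossing. -/
noncomputable def blockNeg : Matrix (Fin 4) (Fin 4) LaurentXY :=
  !![0, -(xPow (-1) * yPow 1), 0, 0;
     -yPow (-1), 1 - xPow (-1), 0, 0;
     0, 0, 0, -(xPow (-1) * yPow 1);
     0, 0, -yPow (-1), 1 - xPow (-1)]

namespace Diagram

variable (D : Diagram)

open Classical in
/-- The block diagonal matrix `M̃`; the index `4i - 3 + a` is written `(i, a)`. -/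
noncomputable def matM : Matrix (D.RealCrossing × Fin 4) (D.RealCrossing × Fin 4) LaurentXY :=
  Matrix.of fun r s =>
    if r.1 = s.1 then (if D.IsPositive r.1.1 then blockPos r.2 s.2 else blockNeg r.2 s.2) else 0

open Classical in
/-- The matrix `P̃`; `Fin.rev a` is `3 - a`. -/
noncomputable def matP : Matrix (D.RealCrossing × Fin 4) (D.RealCrossing × Fin 4) LaurentXY :=
  Matrix.of fun r s =>
    if D.EvenArrow r.1 r.2 s.1 s.2 ∨ D.EvenArrow r.1 r.2.rev s.1 s.2.rev ∨
        D.OddArrow r.1 r.2 s.1 s.2.rev ∨ D.OddArrow r.1 r.2.rev s.1 s.2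
    then 1 else 0

/-- `Z̃_D(x, y) = det (M̃ - P̃)`. -/
noncomputable def Ztilde : LaurentXY := (D.matM - D.matP).det

end Diagram

/-! ## Equivalence of diagrams -/

/-- Two codes of the same diagram: a bijection of the darts respecting the whole structure. -/
def Iso (D E : Diagram) : Prop :=
  ∃ σ : Dart (Fin D.m) (Fin D.n) ≃ Dart (Fin E.m) (Fin E.n),
    (∀ d, σ (ccw d) = ccw (σ d)) ∧ (∀ d, (σ d).isLeft = d.isLeft) ∧
    (∀ d, E.atReal (σ d) = D.atReal d) ∧ (∀ d, E.atBar (σ d) = D.atBar d) ∧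
    (∀ d, D.atReal d = true → isOver (σ d) = isOver d) ∧
    (∀ d, σ (D.link d) = E.link (σ d)) ∧ (∀ d, E.out (σ d) = D.out d)

/-- A picture in a disk with `k` endpoints on the boundary circle, without orientation: `m`
crossings, `n` bars and plain points, the arcs joining two darts (`inner`), and the darts whose
arcs run to the endpoints `0, …, k - 1` (`ends`), which are listed counterclockwise. -/
structure Picture (k : ℕ) where
  m : ℕ
  n : ℕ
  real : Fin m → Bool
  bar : Fin n → Bool
  ends : Fin k → Dart (Fin m) (Fin n)
  inner : List (Dart (Fin m) (Fin n) × Dart (Fin m) (Fin n))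

/-- The darts of a diagram that are seen from outside of a disk containing the crossings `T.m` and
points `T.n` of the picture `T`, where `X` and `J` are the vertices outside of the disk: the darts
at `X` and `J`, and the darts of `T` whose arcs leave the disk. -/
def outerDart {k : ℕ} {X J : Type} (T : Picture k) (D : Diagram) (eX : X ⊕ Fin T.m ≃ Fin D.m)
    (eJ : J ⊕ Fin T.n ≃ Fin D.n) : Dart X J ⊕ Fin k → Dart (Fin D.m) (Fin D.n)
  | Sum.inl (Sum.inl (c, i)) => Sum.inl (eX (Sum.inl c), i)
  | Sum.inl (Sum.inr (p, i)) => Sum.inr (eJ (Sum.inl p), i)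
  | Sum.inr b => Sum.map (Prod.map (eX ∘ Sum.inr) id) (Prod.map (eJ ∘ Sum.inr) id) (T.ends b)

/-- The diagram `D` looks like the picture `T` on the vertices inside of the disk. -/
def Contains {k : ℕ} {X J : Type} (T : Picture k) (D : Diagram) (eX : X ⊕ Fin T.m ≃ Fin D.m)
    (eJ : J ⊕ Fin T.n ≃ Fin D.n) : Prop :=
  (∀ c, D.real (eX (Sum.inr c)) = T.real c) ∧ (∀ p, D.bar (eJ (Sum.inr p)) = T.bar p) ∧
  ∀ a ∈ T.inner,
    D.link (Sum.map (Prod.map (eX ∘ Sum.inr) id) (Prod.map (eJ ∘ Sum.inr) id) a.1) =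
      Sum.map (Prod.map (eX ∘ Sum.inr) id) (Prod.map (eJ ∘ Sum.inr) id) a.2

/-- `E` arises from `D` by replacing the picture `S` in a disk by the picture `T`, while `D` and
`E` agree outside of the disk, including the orientations. -/
def Replace {k : ℕ} (S T : Picture k) (D E : Diagram) : Prop :=
  ∃ (X J : Type) (eX : X ⊕ Fin S.m ≃ Fin D.m) (eJ : J ⊕ Fin S.n ≃ Fin D.n)
    (fX : X ⊕ Fin T.m ≃ Fin E.m) (fJ : J ⊕ Fin T.n ≃ Fin E.n),
    Contains S D eX eJ ∧ Contains T E fX fJ ∧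
    (∀ c, D.real (eX (Sum.inl c)) = E.real (fX (Sum.inl c))) ∧
    (∀ p, D.bar (eJ (Sum.inl p)) = E.bar (fJ (Sum.inl p))) ∧
    (∀ d, D.out (outerDart S D eX eJ d) = E.out (outerDart T E fX fJ d)) ∧
    ∀ d e, D.link (outerDart S D eX eJ d) = outerDart S D eX eJ e ↔
      E.link (outerDart T E fX fJ d) = outerDart T E fX fJ e

namespace Picture

/-- The dart `i` of the crossing `c` of a picture. -/
abbrev cr {m n : ℕ} (c : Fin m) (i : Fin 4) : Dart (Fin m) (Fin n) := Sum.inl (c, i)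

/-- The dart `i` of the bar or plain point `p` of a picture. -/
abbrev pt {m n : ℕ} (p : Fin n) (i : Fin 2) : Dart (Fin m) (Fin n) := Sum.inr (p, i)

/-- An arc with one bar (`b = true`) or with one plain point (`b = false`). -/
def arc (b : Bool) : Picture 2 :=
  ⟨0, 1, ![], ![b], ![pt 0 0, pt 0 1], []⟩

/-- An arc as before with an additional plain point. -/
def arcWithPoint (b : Bool) : Picture 2 :=
  ⟨0, 2, ![], ![b, false], ![pt 1 0, pt 0 1], [(pt 1 1, pt 0 0)]⟩

/-- An arc with two bars. -/
def twoBars : Picture 2 :=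
  ⟨0, 2, ![], ![true, true], ![pt 0 0, pt 1 1], [(pt 0 1, pt 1 0)]⟩

/-- A crossing, real or virtual. -/
def crossing (r : Bool) : Picture 4 :=
  ⟨1, 0, ![r], ![], fun i => cr 0 i, []⟩

/-- A crossing with one bar (`b = true`) or plain point (`b = false`) next to it, on the arc
leaving along the dart `i`. -/
def crossingWithPoint (r b : Bool) (i : Fin 4) : Picture 4 :=
  ⟨1, 1, ![r], ![b], fun l => if l = i then pt 0 0 else cr 0 l, [(pt 0 1, cr 0 i)]⟩

/-- A curl; for a real crossing the two values `s = 0, 1` give the two kinds of curls. -/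
def curl (r : Bool) (s : Fin 4) : Picture 2 :=
  ⟨1, 0, ![r], ![], ![cr 0 s, cr 0 (s + 1)], [(cr 0 (s + 2), cr 0 (s + 3))]⟩

/-- Two vertical arcs without crossings; endpoints: lower left, lower right, upper right,
upper left. -/
def parallelArcs : Picture 4 :=
  ⟨0, 2, ![], ![false, false], ![pt 0 0, pt 1 0, pt 1 1, pt 0 1], []⟩

/-- Two vertical arcs crossing twice; endpoints as before.  The crossing `0` is the lower one,
with darts `0, 1, 2, 3` to the lower left, lower right, upper right and upper left; the crossing
`1` is the upper one, with darts `0, 1, 2, 3` to the lower right, upper right, upper left and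
lower left.  If the crossings are real, the arc with the left endpoints is over the other one. -/
def bigon (r : Bool) : Picture 4 :=
  ⟨2, 0, ![r, r], ![], ![cr 0 0, cr 0 1, cr 1 1, cr 1 2],
    [(cr 0 2, cr 1 0), (cr 0 3, cr 1 3)]⟩

/-- Three lines `L₀, L₁, L₂` in the directions of 0, 60 and 120 degrees, `L₀` passing below the
crossing of `L₁` and `L₂`.  The endpoint `i` is at `60 i` degrees.  The crossings `0, 1, 2` are
those of `L₀, L₁`, of `L₀, L₂` and of `L₁, L₂`, real or virtual according to `r`.  With the offset
`s c = 0` the line of smaller index is over at the real crossing `c`, with `s c = 1` the other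
one. -/
def triangleBelow (r : Fin 3 → Bool) (s : Fin 3 → Fin 4) : Picture 6 :=
  ⟨3, 0, r, ![],
    ![cr 1 (s 1), cr 2 (s 2), cr 2 (s 2 + 1), cr 0 (s 0 + 2), cr 0 (s 0 + 3), cr 1 (s 1 + 3)],
    [(cr 0 (s 0), cr 1 (s 1 + 2)), (cr 0 (s 0 + 1), cr 2 (s 2 + 2)),
      (cr 1 (s 1 + 1), cr 2 (s 2 + 3))]⟩

/-- The same three lines, with `L₀` passing above the crossing of `L₁` and `L₂`. -/
def triangleAbove (r : Fin 3 → Bool) (s : Fin 3 → Fin 4) : Picture 6 :=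
  ⟨3, 0, r, ![],
    ![cr 0 (s 0), cr 0 (s 0 + 1), cr 1 (s 1 + 1), cr 1 (s 1 + 2), cr 2 (s 2 + 2), cr 2 (s 2 + 3)],
    [(cr 1 (s 1), cr 0 (s 0 + 2)), (cr 2 (s 2), cr 0 (s 0 + 3)),
      (cr 2 (s 2 + 1), cr 1 (s 1 + 3))]⟩

/-- A real crossing with a bar on each of the four arcs; endpoints: upper right, upper left,
lower left, lower right.  The over-strand is the one with the upper right endpoint if `s = 0` and
the other one if `s = 1`. -/
def barredCrossing (s : Fin 4) : Picture 4 :=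
  ⟨1, 4, ![true], ![true, true, true, true], ![pt 0 0, pt 1 0, pt 2 0, pt 3 0],
    [(pt 0 1, cr 0 s), (pt 1 1, cr 0 (s + 1)), (pt 2 1, cr 0 (s + 2)), (pt 3 1, cr 0 (s + 3))]⟩

/-- A vertical stack of a virtual crossing (number `1`), a real crossing (number `0`) and a
virtual crossing (number `2`), from top to bottom; endpoints as before.  The over-strand of the
real crossing is the one leaving it to the upper right if `s = 0` and the other one if `s = 1`. -/
def virtualStack (s : Fin 4) : Picture 4 :=
  ⟨3, 0, ![true, false, false], ![], ![cr 1 0, cr 1 1, cr 2 2, cr 2 3],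
    [(cr 0 s, cr 1 3), (cr 0 (s + 1), cr 1 2), (cr 0 (s + 2), cr 2 1), (cr 0 (s + 3), cr 2 0)]⟩

end Picture

open Picture in
/-- One step between diagrams: passing to another code of the same diagram, inserting a plain
point, or a classical, virtual or twisted Reidemeister move. -/
inductive Move : Diagram → Diagram → Prop
  | iso {D E : Diagram} : Iso D E → Move D E
  | pointOnArc {D E : Diagram} (b : Bool) : Replace (arc b) (arcWithPoint b) D E → Move D E
  | pointAtCrossing {D E : Diagram} (r : Bool) (i : Fin 4) :
      Replace (crossing r) (crossingWithPoint r false i) D E → Move D E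
  | R1 {D E : Diagram} (s : Fin 4) (hs : s = 0 ∨ s = 1) :
      Replace (arc false) (curl true s) D E → Move D E
  | R2 {D E : Diagram} : Replace parallelArcs (bigon true) D E → Move D E
    -- `hs` says that the three lines lie at three different heights
  | R3 {D E : Diagram} (s : Fin 3 → Fin 4) (h01 : ∀ c, s c = 0 ∨ s c = 1)
      (hs : s 1 = s 0 ∨ s 1 = s 2) :
      Replace (triangleBelow (fun _ => true) s) (triangleAbove (fun _ => true) s) D E → Move D E
  | V1 {D E : Diagram} : Replace (arc false) (curl false 0) D E → Move D E
  | V2 {D E : Diagram} : Replace parallelArcs (bigon false) D E → Move D E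
  | V3 {D E : Diagram} :
      Replace (triangleBelow (fun _ => false) 0) (triangleAbove (fun _ => false) 0) D E → Move D E
    -- a strand with two virtual crossings passes a real crossing
  | V4 {D E : Diagram} (s : Fin 4) (hs : s = 0 ∨ s = 1) :
      Replace (triangleBelow ![false, false, true] ![0, 0, s])
        (triangleAbove ![false, false, true] ![0, 0, s]) D E → Move D E
    -- a bar passes a virtual crossing
  | T1 {D E : Diagram} :
      Replace (crossingWithPoint false true 0) (crossingWithPoint false true 2) D E → Move D E
    -- two neighbouring bars cancel
  | T2 {D E : Diagram} : Replace (arc false) twoBars D E → Move D E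
  | T3 {D E : Diagram} (s : Fin 4) (hs : s = 0 ∨ s = 1) :
      Replace (barredCrossing s) (virtualStack s) D E → Move D E

/-- Two diagrams represent the same twisted link. -/
def Equivalent (D E : Diagram) : Prop := Relation.EqvGen Move D E

end TwistedLink

/-! The matrix defining `Ztilde` lives on the real crossings, and its edges pass through virtual
crossings and bars, so it is unwieldy under local moves. The proof replaces it by a larger local
system with one unknown for every dart on each of two sheets. Sheet `false` carries the labels 0, 1
and sheet `true` the labels 3, 2. An arc identifies the values at its two ends, a virtual crossing
or plain point passes values straight on, a bar exchanges the sheets, and a real crossing acts by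
the entries of `blockPos` or `blockNeg`. The solutions are the fixed points of `Diagram.transfer`,
and `Diagram.fullDet` is det(1 - transfer) up to the sign of the number of bars. It makes sense for
every diagram, so the intermediate diagrams of a sequence of moves need no restriction.

Invariance is a Schur complement argument. If the equations inside a disk have invertible
determinant, the inner unknowns can be eliminated, and what remains depends only on the relation
that the picture imposes on its endpoints (`LinearMap.det_one_sub_eq_of_eliminate`). Hence
`Replace.fullDet_eq`: two pictures with the same relation, the same bar parity and inner
determinants that are powers of x are interchangeable up to a power of x. For all moves except the
real curl the inner system is unipotent, and both this and the equality of relations are finite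
computations. A real curl has inner determinant x or its inverse, and its relation is verified by
hand.

For a diagram in which every loop meets a real crossing, one eliminates all darts except those
entering real crossings. This leaves 1 - MU, with M the crossing matrix and U the permutation matrix
of the edges of |D| on both sheets. The matrix `matP` is the transpose of U, so (M - `matP`)U = -(1
- MU). The size is even and det U is the bar sign, which gives `Ztilde` = `fullDet`
(`NoFreeCircle.ztilde_eq_fullDet`). -/

section Elimination

/-! ### Elimination of unknowns by Schur complements. -/

open Matrix

variable {R : Type*} [CommRing R]

/-- A matrix whose nonzero entries strictly decrease a rank function is unipotent after being
subtracted from the identity. -/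
theorem Matrix.det_one_sub_eq_one_of_rank {i : Type*} [Fintype i] [DecidableEq i]
    (Q : Matrix i i R) (r : i → ℕ) (h : ∀ a b, r a ≤ r b → Q a b = 0) : (1 - Q).det = 1 := by
  -- The order is reversed because entries may be nonzero only from larger to strictly smaller rank.
  -- Each diagonal block is an identity matrix, as `Q` also vanishes between equal ranks.
  have ht : (1 - Q).BlockTriangular (fun a => OrderDual.toDual (r a)) := by
    intro a b hab
    have hab' : r a < r b := hab
    have hne : a ≠ b := by rintro rfl; exact lt_irrefl _ hab'
    simp [Matrix.sub_apply, hne, h a b hab'.le]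
  rw [ht.det]
  refine Finset.prod_eq_one fun k _ => ?_
  have : (1 - Q).toSquareBlock (fun a => OrderDual.toDual (r a)) k = 1 := by
    ext ⟨a, ha⟩ ⟨b, hb⟩
    have hab : r a ≤ r b := by
      have : OrderDual.toDual (r a) = OrderDual.toDual (r b) := ha.trans hb.symm
      exact le_of_eq (OrderDual.toDual.injective this)
    simp [Matrix.toSquareBlock, Matrix.toSquareBlockProp, Matrix.sub_apply, h a b hab,
      Matrix.one_apply, Subtype.ext_iff]
  rw [this, Matrix.det_one]

theorem Matrix.det_neg_of_even_card {n : Type*} [Fintype n] [DecidableEq n]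
    (h : Even (Fintype.card n)) (A : Matrix n n R) : (-A).det = A.det := by
  rw [Matrix.det_neg, h.neg_one_pow, one_mul]

/-- The restriction of a linear operator to the coordinates in the range of `g`. -/
def LinearMap.compress {ι i : Type*} [Fintype i] [DecidableEq ι]
    (T : (ι → R) →ₗ[R] (ι → R)) (g : i → ι) : (i → R) →ₗ[R] (i → R) :=
  LinearMap.funLeft R R g ∘ₗ T ∘ₗ ∑ a, (LinearMap.single R (fun _ : ι => R) (g a)) ∘ₗ
    LinearMap.proj a

theorem LinearMap.toMatrix'_compress {ι i : Type*} [Fintype i] [Fintype ι] [DecidableEq ι]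
    [DecidableEq i] (T : (ι → R) →ₗ[R] (ι → R)) (g : i → ι) (a b : i) :
    LinearMap.toMatrix' (T.compress g) a b = T (Pi.single (g b) 1) (g a) := by
  have : ∑ c : i, (Pi.single (g c) ((Pi.single b 1 : i → R) c) : ι → R) = Pi.single (g b) 1 := by
    rw [Finset.sum_eq_single b]
    · simp
    · intro c _ hc; simp [hc]
    · simp
  simp [LinearMap.toMatrix'_apply, LinearMap.compress, LinearMap.funLeft_apply,
    this]

/-- Elimination of the interior coordinates `i` of an operator `T`. -/
theorem LinearMap.exists_eliminate {ι o i : Type*} [Fintype ι] [DecidableEq ι] [Fintype o]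
    [DecidableEq o] [Fintype i] [DecidableEq i] (T : (ι → R) →ₗ[R] (ι → R))
    (f : o → ι) (g : i → ι) (hfg : Function.Bijective (Sum.elim f g))
    (hu : IsUnit (1 - LinearMap.toMatrix' (T.compress g)).det) :
    ∃ τ : Matrix o o R,
      (1 - LinearMap.toMatrix' T).det =
        (1 - LinearMap.toMatrix' (T.compress g)).det * (1 - τ).det ∧
      ∀ w : o → R, ∃ v : ι → R, (∀ a, v (f a) = w a) ∧ (∀ a, v (g a) = T v (g a)) ∧
        ∀ a, T v (f a) = (τ *ᵥ w) a := by
  classical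
  let e : o ⊕ i ≃ ι := Equiv.ofBijective _ hfg
  let Q := LinearMap.toMatrix' T
  have hTQ : ∀ v, T v = Q *ᵥ v := fun v => by
    simp [Q, LinearMap.toMatrix'_mulVec]
  let Qoo : Matrix o o R := Q.submatrix f f
  let Qoi : Matrix o i R := Q.submatrix f g
  let Qio : Matrix i o R := Q.submatrix g f
  let Qii : Matrix i i R := Q.submatrix g g
  have hii : LinearMap.toMatrix' (T.compress g) = Qii := by
    ext a b
    rw [LinearMap.toMatrix'_compress]
    simp [Qii, Q, LinearMap.toMatrix'_apply, Pi.single]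
  rw [hii] at hu ⊢
  have hblocks : (1 - Q).submatrix e e = fromBlocks (1 - Qoo) (-Qoi) (-Qio) (1 - Qii) := by
    ext (a | a) (b | b)
    · have : f a = f b ↔ a = b := by
        simpa using (hfg.1.eq_iff (a := Sum.inl a) (b := Sum.inl b))
      simp [e, Qoo, Matrix.one_apply, this]
    · have : f a ≠ g b := fun h => by
        simpa using hfg.1 (a₁ := Sum.inl a) (a₂ := Sum.inr b) h
      simp [e, Qoi, this]
    · have : g a ≠ f b := fun h => by
        simpa using hfg.1 (a₁ := Sum.inr a) (a₂ := Sum.inl b) h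
      simp [e, Qio, this]
    · have : g a = g b ↔ a = b := by
        simpa using (hfg.1.eq_iff (a := Sum.inr a) (b := Sum.inr b))
      simp [e, Qii, Matrix.one_apply, this]
  have hinv : (1 - Qii) * (1 - Qii)⁻¹ = 1 := Matrix.mul_nonsing_inv _ hu
  -- `U` expresses the interior coordinates of a solution of the interior equations through the
  -- outer ones.
  obtain ⟨U, h0⟩ : ∃ U : Matrix i o R, (1 - Qii) * U = Qio :=
    ⟨(1 - Qii)⁻¹ * Qio, by rw [← Matrix.mul_assoc, hinv, Matrix.one_mul]⟩
  have hU : U = Qio + Qii * U := by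
    rw [← h0, Matrix.sub_mul, Matrix.one_mul, sub_add_cancel]
  have hsum : ∀ (v : ι → R) (x : ι), T v x =
      ∑ b, Q x (f b) * v (f b) + ∑ c, Q x (g c) * v (g c) := by
    intro v x
    rw [hTQ, Matrix.mulVec, dotProduct, ← e.sum_comp, Fintype.sum_sum_type]
    rfl
  -- Substituting the interior solution into the outer rows; 1 minus this matrix is the Schur
  -- complement of 1 - Qii.
  refine ⟨Qoo + Qoi * U, ?_, ?_⟩
  · rw [← Matrix.det_submatrix_equiv_self e (1 - Q), hblocks]
    have hmul : fromBlocks (1 - Qoo) (-Qoi) (-Qio) (1 - Qii) * fromBlocks 1 0 U 1 =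
        fromBlocks (1 - (Qoo + Qoi * U)) (-Qoi) 0 (1 - Qii) := by
      rw [Matrix.fromBlocks_multiply]
      simp [h0, sub_sub, ← sub_eq_add_neg]
    have := congrArg Matrix.det hmul
    rw [Matrix.det_mul, Matrix.det_fromBlocks_zero₁₂, Matrix.det_fromBlocks_zero₂₁] at this
    simpa [mul_comm] using this
  · intro w
    let v : ι → R := fun x => Sum.elim w (U *ᵥ w) (e.symm x)
    have hvf : ∀ a, v (f a) = w a := fun a => by
      have : e.symm (f a) = Sum.inl a := by rw [Equiv.symm_apply_eq]; rfl
      simp [v, this]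
    have hvg : ∀ a, v (g a) = (U *ᵥ w) a := fun a => by
      have : e.symm (g a) = Sum.inr a := by rw [Equiv.symm_apply_eq]; rfl
      simp [v, this]
    refine ⟨v, hvf, fun a => ?_, fun a => ?_⟩
    · rw [hsum, hvg]
      simp only [hvf, hvg]
      have := congrFun (congrArg (· *ᵥ w) hU) a
      simp only [Matrix.add_mulVec, ← Matrix.mulVec_mulVec] at this
      exact this
    · rw [hsum]
      simp only [hvf, hvg]
      rw [Matrix.add_mulVec, ← Matrix.mulVec_mulVec]
      rfl

/-- Two operators with invertible interiors, and for which solutions of the interior equations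
have the same values at the remaining coordinates, have the same determinant up to the
determinants of the interiors. -/
theorem LinearMap.det_one_sub_eq_of_eliminate {ι ι' o i i' : Type*} [Fintype ι] [DecidableEq ι]
    [Fintype ι'] [DecidableEq ι'] [Finite o]
    [Fintype i] [DecidableEq i] [Fintype i'] [DecidableEq i']
    (T : (ι → R) →ₗ[R] (ι → R)) (T' : (ι' → R) →ₗ[R] (ι' → R))
    (f : o → ι) (g : i → ι) (hfg : Function.Bijective (Sum.elim f g))
    (f' : o → ι') (g' : i' → ι') (hfg' : Function.Bijective (Sum.elim f' g'))
    (hu : IsUnit (1 - LinearMap.toMatrix' (T.compress g)).det)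
    (hu' : IsUnit (1 - LinearMap.toMatrix' (T'.compress g')).det)
    (h : ∀ v v', (∀ a, v (f a) = v' (f' a)) → (∀ a, v (g a) = T v (g a)) →
      (∀ a, v' (g' a) = T' v' (g' a)) → ∀ a, T v (f a) = T' v' (f' a)) :
    ∃ δ : R, (1 - LinearMap.toMatrix' T).det =
        (1 - LinearMap.toMatrix' (T.compress g)).det * δ ∧
      (1 - LinearMap.toMatrix' T').det =
        (1 - LinearMap.toMatrix' (T'.compress g')).det * δ := by
  classical
  have := Fintype.ofFinite o
  obtain ⟨τ, h1, h2⟩ := T.exists_eliminate f g hfg hu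
  obtain ⟨τ', h1', h2'⟩ := T'.exists_eliminate f' g' hfg' hu'
  -- The reduced matrices are compared column by column, on solutions whose outer values form a
  -- basis vector.
  have hτ : τ = τ' := by
    ext a b
    obtain ⟨v, hv1, hv2, hv3⟩ := h2 (Pi.single b 1)
    obtain ⟨v', hv1', hv2', hv3'⟩ := h2' (Pi.single b 1)
    have := h v v' (fun c => by rw [hv1, hv1']) hv2 hv2' a
    rw [hv3, hv3'] at this
    simpa using this
  exact ⟨_, h1, by rw [h1', hτ]⟩

end Elimination

namespace TwistedLink

/-! ## The transfer operator of a diagram -/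

theorem xPow_add (k l : ℤ) : xPow (k + l) = xPow k * xPow l := by
  rw [xPow, xPow, xPow, LaurentPolynomial.T_add, map_mul]

theorem xPow_zero : xPow 0 = 1 := by simp [xPow]

theorem yPow_add (k l : ℤ) : yPow (k + l) = yPow k * yPow l := LaurentPolynomial.T_add k l

theorem yPow_zero : yPow 0 = 1 := LaurentPolynomial.T_zero

theorem xPow_mul_neg (k : ℤ) : xPow k * xPow (-k) = 1 := by
  rw [← xPow_add, add_neg_cancel, xPow_zero]

theorem yPow_mul_neg (k : ℤ) : yPow k * yPow (-k) = 1 := by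
  rw [← yPow_add, add_neg_cancel, yPow_zero]

theorem isUnit_xPow (k : ℤ) : IsUnit (xPow k) := IsUnit.of_mul_eq_one _ (xPow_mul_neg k)

/-- The coefficient for going straight on at a real crossing of the given sign, on the strand that
is active or passive. -/
noncomputable def straight : Bool → Bool → LaurentXY
  | true, true => -yPow 1
  | true, false => -(xPow 1 * yPow (-1))
  | false, true => -yPow (-1)
  | false, false => -(xPow (-1) * yPow 1)

/-- The coefficient for turning from the active strand to the passive one. -/
noncomputable def turn : Bool → Bool → LaurentXY
  | true, true => 1 - xPow 1
  | false, true => 1 - xPow (-1)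
  | _, false => 0

section Step

variable {X J : Type} (real : X → Bool) (bar : J → Bool) (out : Dart X J → Bool)

/-- The sign of the crossing at a dart (`true` if positive). -/
def signAt (d : Dart X J) : Bool := xor (isOver d) (xor (out (ccw d)) (out d))

/-- The value at a dart entering a vertex in terms of the values at the darts leaving it.  The
second component of `Dart X J × Bool` is the sheet; on the sheet `false` the over-strand is
active, on the sheet `true` the under-strand, and bars exchange the sheets. -/
noncomputable def vertexStep (v : Dart X J × Bool → LaurentXY) : Dart X J × Bool → LaurentXY
  | (Sum.inr (p, i), s) => v (Sum.inr (p, i + 1), xor s (bar p))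
  | (Sum.inl (c, i), s) =>
    if real c then
      straight (signAt out (Sum.inl (c, i))) (xor (isOver (Sum.inl (c, i) : Dart X J)) s) *
          v (Sum.inl (c, i + 2), s) +
        turn (signAt out (Sum.inl (c, i))) (xor (isOver (Sum.inl (c, i) : Dart X J)) s) *
          v (Sum.inl (c, if out (Sum.inl (c, i + 1)) then i + 1 else i + 3), s)
    else v (Sum.inl (c, i + 2), s)

/-- The operator whose fixed points are the assignments of values to darts satisfying the
equations of all arcs and vertices. -/
noncomputable def step (lk : Dart X J → Dart X J) :
    (Dart X J × Bool → LaurentXY) →ₗ[LaurentXY] (Dart X J × Bool → LaurentXY) where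
  -- An outgoing dart reads the other end of its arc, an incoming dart reads outgoing darts of its
  -- own vertex. Thus each dart and sheet has exactly one equation.
  toFun v a := if out a.1 then v (lk a.1, a.2) else vertexStep real bar out v a
  map_add' v w := by
    funext ⟨d, s⟩
    rcases d with ⟨c, i⟩ | ⟨p, i⟩ <;> simp only [vertexStep, Pi.add_apply] <;> split_ifs <;> ring
  map_smul' a v := by
    funext ⟨d, s⟩
    rcases d with ⟨c, i⟩ | ⟨p, i⟩ <;>
      simp only [vertexStep, Pi.smul_apply, smul_eq_mul, RingHom.id_apply] <;> split_ifs <;> ring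

theorem step_apply_of_out {lk : Dart X J → Dart X J} {d : Dart X J} (h : out d = true) (s : Bool)
    (v : Dart X J × Bool → LaurentXY) : step real bar out lk v (d, s) = v (lk d, s) := by
  simp [step, h]

theorem step_apply_of_in {lk : Dart X J → Dart X J} {d : Dart X J} (h : out d = false) (s : Bool)
    (v : Dart X J × Bool → LaurentXY) :
    step real bar out lk v (d, s) = vertexStep real bar out v (d, s) := by
  simp [step, h]

variable {X' J' : Type}

/-- The map of darts induced by maps of vertices. -/
def mapDart (f : X → X') (g : J → J') : Dart X J → Dart X' J' :=
  Sum.map (Prod.map f id) (Prod.map g id)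

theorem mapDart_injective {f : X → X'} {g : J → J'} (hf : Function.Injective f)
    (hg : Function.Injective g) : Function.Injective (mapDart f g) :=
  (hf.prodMap Function.injective_id).sumMap (hg.prodMap Function.injective_id)

theorem mapDart_opp (f : X → X') (g : J → J') (d : Dart X J) :
    mapDart f g (opp d) = opp (mapDart f g d) := by
  rcases d with ⟨c, i⟩ | ⟨p, i⟩ <;> rfl

/-- The equation at a vertex refers only to darts of this vertex, so it is insensitive to embedding
the vertex into a larger diagram. -/
theorem vertexStep_mapDart {f : X → X'} {g : J → J'} {real' : X' → Bool} {bar' : J' → Bool}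
    {out' : Dart X' J' → Bool} (hr : ∀ c, real' (f c) = real c) (hb : ∀ p, bar' (g p) = bar p)
    (ho : ∀ d, out' (mapDart f g d) = out d) (v : Dart X' J' × Bool → LaurentXY)
    (d : Dart X J) (s : Bool) :
    vertexStep real' bar' out' v (mapDart f g d, s) =
      vertexStep real bar out (fun a => v (mapDart f g a.1, a.2)) (d, s) := by
  rcases d with ⟨c, i⟩ | ⟨p, i⟩
  · have h1 : ∀ i, out' (Sum.inl (f c, i)) = out (Sum.inl (c, i)) := fun i => ho (Sum.inl (c, i))
    simp only [mapDart, Sum.map_inl, Prod.map_apply, id, vertexStep, hr, h1, signAt, ccw, isOver]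
  · simp [mapDart, vertexStep, hb]

end Step

namespace Diagram

variable (D : Diagram)

/-- The transfer operator of a diagram. -/
noncomputable def transfer :
    (Dart (Fin D.m) (Fin D.n) × Bool → LaurentXY) →ₗ[LaurentXY]
      (Dart (Fin D.m) (Fin D.n) × Bool → LaurentXY) :=
  step D.real D.bar D.out D.link

/-- The parity of the number of bars, as a sign. -/
noncomputable def barSign : LaurentXY := ∏ p, if D.bar p then -1 else 1

/-- The determinant of the equations for all arcs and all vertices of a diagram. -/
noncomputable def fullDet : LaurentXY :=
  -- The sign compensates the determinant of the edge permutation in the comparison with `Ztilde`;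
  -- the moves preserve it.
  D.barSign * (1 - LinearMap.toMatrix' D.transfer).det

end Diagram

/-! ## Local replacement -/

namespace Picture

variable {k : ℕ} (S : Picture k)

/-- The other end of an inner arc of a picture. -/
def partner (p : Dart (Fin S.m) (Fin S.n)) : Dart (Fin S.m) (Fin S.n) :=
  match S.inner.find? fun a => a.1 = p ∨ a.2 = p with
  | some a => if a.1 = p then a.2 else a.1
  -- Irrelevant default: in a well-formed picture only endpoint darts have no partner, and no
  -- equation of an inner arc asks for theirs.
  | none => p

/-- The darts of the inner arcs of a picture. -/
abbrev Interior : Type := {p : Dart (Fin S.m) (Fin S.n) // ∀ b, S.ends b ≠ p}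

/-- The endpoints belong to different darts, and the other darts are paired by the inner arcs. -/
structure WellFormed : Prop where
  ends_injective : ∀ b c, S.ends b = S.ends c → b = c
  partner_mem : ∀ p, (∀ b, S.ends b ≠ p) →
    (p, S.partner p) ∈ S.inner ∨ (S.partner p, p) ∈ S.inner
  partner_ne : ∀ p, (∀ b, S.ends b ≠ p) → ∀ b, S.ends b ≠ S.partner p

/-- A consistent orientation of the arcs of a picture. -/
structure Orients (out : Dart (Fin S.m) (Fin S.n) → Bool) : Prop where
  out_opp : ∀ p, out (opp p) = !out p
  out_inner : ∀ a ∈ S.inner, out a.2 = !out a.1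

/-- The transfer operator of a picture. -/
noncomputable def transfer (out : Dart (Fin S.m) (Fin S.n) → Bool) :
    (Dart (Fin S.m) (Fin S.n) × Bool → LaurentXY) →ₗ[LaurentXY]
      (Dart (Fin S.m) (Fin S.n) × Bool → LaurentXY) :=
  step S.real S.bar out S.partner

/-- The determinant of the equations for the inner arcs. -/
noncomputable def interiorDet (out : Dart (Fin S.m) (Fin S.n) → Bool) : LaurentXY :=
  (1 - LinearMap.toMatrix'
    ((S.transfer out).compress fun a : S.Interior × Bool => (a.1.1, a.2))).det

/-- An assignment of values satisfying the equations for the inner arcs. -/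
def IsSolution (out : Dart (Fin S.m) (Fin S.n) → Bool)
    (v : Dart (Fin S.m) (Fin S.n) × Bool → LaurentXY) : Prop :=
  ∀ p, (∀ b, S.ends b ≠ p) → ∀ s, v (p, s) = S.transfer out v (p, s)

/-- The parity of the number of bars of a picture, as a sign. -/
noncomputable def barSign : LaurentXY := ∏ p, if S.bar p then -1 else 1

/-- Two pictures impose the same relations on the values at the endpoints. -/
def SameRelation (S T : Picture k) : Prop :=
  ∀ outS outT, S.Orients outS → T.Orients outT → (∀ b, outS (S.ends b) = outT (T.ends b)) →
    ∀ v w, S.IsSolution outS v → T.IsSolution outT w →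
      (∀ b s, v (S.ends b, s) = w (T.ends b, s)) → ∀ b, outS (S.ends b) = false → ∀ s,
        vertexStep S.real S.bar outS v (S.ends b, s) = vertexStep T.real T.bar outT w (T.ends b, s)

/-- The equations for the inner arcs can be solved. -/
def Solvable : Prop := ∀ out, S.Orients out → ∃ j : ℤ, S.interiorDet out = xPow j

end Picture

section Replace

variable {k : ℕ} {X J : Type} {S : Picture k} {D : Diagram} {eX : X ⊕ Fin S.m ≃ Fin D.m}
  {eJ : J ⊕ Fin S.n ≃ Fin D.n}

/-- The darts of a picture as darts of a diagram. -/
def innerDart (S : Picture k) (D : Diagram) (eX : X ⊕ Fin S.m ≃ Fin D.m)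
    (eJ : J ⊕ Fin S.n ≃ Fin D.n) : Dart (Fin S.m) (Fin S.n) → Dart (Fin D.m) (Fin D.n) :=
  mapDart (eX ∘ Sum.inr) (eJ ∘ Sum.inr)

theorem outerDart_inl (d : Dart X J) :
    outerDart S D eX eJ (Sum.inl d) = mapDart (eX ∘ Sum.inl) (eJ ∘ Sum.inl) d := by
  rcases d with ⟨c, i⟩ | ⟨p, i⟩ <;> rfl

theorem innerDart_injective : Function.Injective (innerDart S D eX eJ) :=
  mapDart_injective (eX.injective.comp Sum.inr_injective) (eJ.injective.comp Sum.inr_injective)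

theorem outerDart_inl_ne_innerDart (d : Dart X J) (p : Dart (Fin S.m) (Fin S.n)) :
    outerDart S D eX eJ (Sum.inl d) ≠ innerDart S D eX eJ p := by
  rcases d with ⟨c, i⟩ | ⟨c, i⟩ <;> rcases p with ⟨p, i⟩ | ⟨p, i⟩ <;>
    simp [outerDart, innerDart, mapDart]

theorem outerDart_injective (hS : S.WellFormed) : Function.Injective (outerDart S D eX eJ) := by
  rintro (d | b) (e | c) h
  · rw [outerDart_inl, outerDart_inl] at h
    rw [mapDart_injective (eX.injective.comp Sum.inl_injective)
      (eJ.injective.comp Sum.inl_injective) h]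
  · exact absurd h (outerDart_inl_ne_innerDart d _)
  · exact absurd h.symm (outerDart_inl_ne_innerDart e _)
  · rw [hS.ends_injective b c (innerDart_injective h)]

theorem outerDart_ne_innerDart (d : Dart X J ⊕ Fin k) (p : S.Interior) :
    outerDart S D eX eJ d ≠ innerDart S D eX eJ p.1 := by
  rcases d with d | b
  · exact outerDart_inl_ne_innerDart d _
  · exact fun h => p.2 b (innerDart_injective h)

theorem exists_outerDart_or_innerDart (d : Dart (Fin D.m) (Fin D.n)) :
    (∃ e, outerDart S D eX eJ e = d) ∨ ∃ p : S.Interior, innerDart S D eX eJ p.1 = d := by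
  have key : (∃ e, outerDart S D eX eJ (Sum.inl e) = d) ∨ ∃ p, innerDart S D eX eJ p = d := by
    rcases d with ⟨c, i⟩ | ⟨c, i⟩
    · obtain ⟨x | x, rfl⟩ := eX.surjective c
      · exact Or.inl ⟨Sum.inl (x, i), rfl⟩
      · exact Or.inr ⟨Sum.inl (x, i), rfl⟩
    · obtain ⟨x | x, rfl⟩ := eJ.surjective c
      · exact Or.inl ⟨Sum.inr (x, i), rfl⟩
      · exact Or.inr ⟨Sum.inr (x, i), rfl⟩
  rcases key with ⟨e, he⟩ | ⟨p, hp⟩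
  · exact Or.inl ⟨_, he⟩
  · by_cases h : ∃ b, S.ends b = p
    · obtain ⟨b, rfl⟩ := h
      exact Or.inl ⟨Sum.inr b, hp⟩
    · exact Or.inr ⟨⟨p, fun b hb => h ⟨b, hb⟩⟩, hp⟩

theorem bijective_outerDart_innerDart (hS : S.WellFormed) :
    Function.Bijective (Sum.elim
      (fun a : (Dart X J ⊕ Fin k) × Bool => (outerDart S D eX eJ a.1, a.2))
      (fun a : S.Interior × Bool => (innerDart S D eX eJ a.1.1, a.2))) := by
  constructor
  · rintro (⟨d, s⟩ | ⟨d, s⟩) (⟨e, t⟩ | ⟨e, t⟩) h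
    · simp only [Sum.elim_inl, Prod.mk.injEq] at h
      rw [outerDart_injective hS h.1, h.2]
    · simp only [Sum.elim_inl, Sum.elim_inr, Prod.mk.injEq] at h
      exact absurd h.1 (outerDart_ne_innerDart _ _)
    · simp only [Sum.elim_inl, Sum.elim_inr, Prod.mk.injEq] at h
      exact absurd h.1.symm (outerDart_ne_innerDart _ _)
    · simp only [Sum.elim_inr, Prod.mk.injEq] at h
      rw [Subtype.ext (innerDart_injective h.1), h.2]
  · rintro ⟨d, s⟩
    rcases exists_outerDart_or_innerDart (eX := eX) (eJ := eJ) d with ⟨e, rfl⟩ | ⟨p, rfl⟩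
    · exact ⟨Sum.inl (e, s), rfl⟩
    · exact ⟨Sum.inr (p, s), rfl⟩

theorem link_innerDart (hS : S.WellFormed) (h : Contains S D eX eJ) (p : S.Interior) :
    D.link (innerDart S D eX eJ p.1) = innerDart S D eX eJ (S.partner p.1) := by
  rcases hS.partner_mem p.1 p.2 with hp | hp
  · exact h.2.2 _ hp
  · have := h.2.2 _ hp
    change D.link (innerDart S D eX eJ (S.partner p.1)) = innerDart S D eX eJ p.1 at this
    rw [← this, D.link_link]

/-- Interior darts are linked among themselves and `link` is an involution, so no arc leads from an
outer dart to an interior one. -/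
theorem exists_link_outerDart (hS : S.WellFormed) (h : Contains S D eX eJ)
    (d : Dart X J ⊕ Fin k) : ∃ e, D.link (outerDart S D eX eJ d) = outerDart S D eX eJ e := by
  rcases exists_outerDart_or_innerDart (eX := eX) (eJ := eJ) (D.link (outerDart S D eX eJ d)) with
    ⟨e, he⟩ | ⟨p, hp⟩
  · exact ⟨e, he.symm⟩
  · have h1 := link_innerDart hS h p
    rw [hp, D.link_link] at h1
    exact absurd h1 (outerDart_ne_innerDart d ⟨S.partner p.1, hS.partner_ne p.1 p.2⟩)

theorem orients_innerDart (h : Contains S D eX eJ) :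
    S.Orients fun p => D.out (innerDart S D eX eJ p) where
  out_opp p := by rw [innerDart, mapDart_opp, D.out_opp]
  out_inner a ha := by
    have := h.2.2 a ha
    change D.link (innerDart S D eX eJ a.1) = innerDart S D eX eJ a.2 at this
    rw [← this, D.out_link]

theorem vertexStep_innerDart (h : Contains S D eX eJ)
    (v : Dart (Fin D.m) (Fin D.n) × Bool → LaurentXY) (p : Dart (Fin S.m) (Fin S.n)) (s : Bool) :
    vertexStep D.real D.bar D.out v (innerDart S D eX eJ p, s) =
      vertexStep S.real S.bar (fun p => D.out (innerDart S D eX eJ p))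
        (fun a => v (innerDart S D eX eJ a.1, a.2)) (p, s) :=
  vertexStep_mapDart _ _ _ h.1 h.2.1 (fun _ => rfl) v p s

theorem vertexStep_outerDart_inl (v : Dart (Fin D.m) (Fin D.n) × Bool → LaurentXY)
    (d : Dart X J) (s : Bool) :
    vertexStep D.real D.bar D.out v (outerDart S D eX eJ (Sum.inl d), s) =
      vertexStep (fun c => D.real (eX (Sum.inl c))) (fun p => D.bar (eJ (Sum.inl p)))
        (fun d => D.out (outerDart S D eX eJ (Sum.inl d)))
        (fun a => v (outerDart S D eX eJ (Sum.inl a.1), a.2)) (d, s) := by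
  simp only [outerDart_inl]
  exact vertexStep_mapDart (f := eX ∘ Sum.inl) (g := eJ ∘ Sum.inl) _ _ _ (fun _ => rfl)
    (fun _ => rfl) (fun _ => rfl) v d s

/-- Both the arc and the vertex of an interior dart lie in the disk, so its equation is already an
equation of the picture. -/
theorem transfer_innerDart (hS : S.WellFormed) (h : Contains S D eX eJ)
    (v : Dart (Fin D.m) (Fin D.n) × Bool → LaurentXY) (p : S.Interior) (s : Bool) :
    D.transfer v (innerDart S D eX eJ p.1, s) =
      S.transfer (fun p => D.out (innerDart S D eX eJ p))
        (fun a => v (innerDart S D eX eJ a.1, a.2)) (p.1, s) := by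
  by_cases ho : D.out (innerDart S D eX eJ p.1) = true
  · rw [Diagram.transfer, step_apply_of_out _ _ _ ho, link_innerDart hS h]
    exact (step_apply_of_out S.real S.bar (fun p => D.out (innerDart S D eX eJ p))
      (lk := S.partner) ho s fun a => v (innerDart S D eX eJ a.1, a.2)).symm
  · rw [Bool.not_eq_true] at ho
    rw [Diagram.transfer, step_apply_of_in _ _ _ ho, vertexStep_innerDart h]
    exact (step_apply_of_in S.real S.bar (fun p => D.out (innerDart S D eX eJ p))
      (lk := S.partner) ho s fun a => v (innerDart S D eX eJ a.1, a.2)).symm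

theorem det_compress_innerDart (hS : S.WellFormed) (h : Contains S D eX eJ) :
    (1 - LinearMap.toMatrix' (D.transfer.compress
      fun a : S.Interior × Bool => (innerDart S D eX eJ a.1.1, a.2))).det =
      S.interiorDet fun p => D.out (innerDart S D eX eJ p) := by
  rw [Picture.interiorDet]
  congr 2
  ext1 ⟨p, s⟩ ⟨q, t⟩
  rw [LinearMap.toMatrix'_compress, LinearMap.toMatrix'_compress, transfer_innerDart hS h]
  have : (fun a : Dart (Fin S.m) (Fin S.n) × Bool =>
      (Pi.single (innerDart S D eX eJ q.1, t) 1 : _ → LaurentXY) (innerDart S D eX eJ a.1, a.2)) =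
        Pi.single (q.1, t) 1 := by
    funext ⟨a, u⟩
    simp [Pi.single_apply, innerDart_injective.eq_iff]
  exact congrArg (fun w => S.transfer (fun p => D.out (innerDart S D eX eJ p)) w (p.1, s)) this

theorem barSign_eq (h : Contains S D eX eJ) [Fintype J] :
    D.barSign = (∏ p : J, if D.bar (eJ (Sum.inl p)) then -1 else 1) * S.barSign := by
  rw [Diagram.barSign, ← eJ.prod_comp, Fintype.prod_sum_type, Picture.barSign]
  simp only [h.2.1]

end Replace

/-- Replacing a picture by another one that imposes the same relation multiplies the determinant
by a power of `x`. -/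
theorem Replace.fullDet_eq {k : ℕ} {S T : Picture k} {D E : Diagram} (h : Replace S T D E)
    (hS : S.WellFormed) (hT : T.WellFormed) (hSd : S.Solvable) (hTd : T.Solvable)
    (hb : S.barSign = T.barSign) (hST : S.SameRelation T) :
    ∃ m : ℤ, E.fullDet = xPow m * D.fullDet := by
  classical
  obtain ⟨X, J, eX, eJ, fX, fJ, hSD, hTE, hreal, hbar, hout, hlink⟩ := h
  have : Finite (X ⊕ Fin S.m) := Finite.of_equiv _ eX.symm
  have : Finite X := Finite.of_injective _ (Sum.inl_injective (β := Fin S.m))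
  have : Finite (J ⊕ Fin S.n) := Finite.of_equiv _ eJ.symm
  have : Finite J := Finite.of_injective _ (Sum.inl_injective (β := Fin S.n))
  have := Fintype.ofFinite J
  obtain ⟨j, hj⟩ := hSd _ (orients_innerDart hSD)
  obtain ⟨l, hl⟩ := hTd _ (orients_innerDart hTE)
  rw [← det_compress_innerDart hS hSD] at hj
  rw [← det_compress_innerDart hT hTE] at hl
  obtain ⟨δ, h1, h2⟩ := LinearMap.det_one_sub_eq_of_eliminate D.transfer E.transfer
    (o := (Dart X J ⊕ Fin k) × Bool)
    _ _ (bijective_outerDart_innerDart hS) _ _ (bijective_outerDart_innerDart hT)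
    (by rw [hj]; exact isUnit_xPow j) (by rw [hl]; exact isUnit_xPow l) (by
      rintro v w hvw hv hw ⟨d, s⟩
      have hvw' : ∀ d s, v (outerDart S D eX eJ d, s) = w (outerDart T E fX fJ d, s) :=
        fun d s => hvw (d, s)
      -- An outgoing dart reads along an arc, and these arcs correspond by `hlink`. An incoming dart
      -- reads at its vertex: outside of the disk the vertices agree, at an endpoint of the disk the
      -- pictures must impose the same relation.
      cases ho : D.out (outerDart S D eX eJ d) with
      | true =>
        have ho' := ho
        rw [hout] at ho'
        obtain ⟨e, he⟩ := exists_link_outerDart hS hSD d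
        rw [Diagram.transfer, step_apply_of_out _ _ _ ho, Diagram.transfer,
          step_apply_of_out _ _ _ ho', he, (hlink d e).1 he]
        exact hvw' e s
      | false =>
        have ho' := ho
        rw [hout] at ho'
        rw [Diagram.transfer, step_apply_of_in _ _ _ ho, Diagram.transfer,
          step_apply_of_in _ _ _ ho']
        rcases d with d | b
        · rw [vertexStep_outerDart_inl, vertexStep_outerDart_inl]
          simp only [hreal, hbar, hout, hvw']
        · have := hST _ _ (orients_innerDart hSD) (orients_innerDart hTE)
            (fun b => hout (Sum.inr b)) (fun a => v (innerDart S D eX eJ a.1, a.2))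
            (fun a => w (innerDart T E fX fJ a.1, a.2))
            (fun p hp s => by
              rw [← transfer_innerDart hS hSD v ⟨p, hp⟩ s]
              exact hv (⟨p, hp⟩, s))
            (fun p hp s => by
              rw [← transfer_innerDart hT hTE w ⟨p, hp⟩ s]
              exact hw (⟨p, hp⟩, s))
            (fun b s => hvw' (Sum.inr b) s) b ho s
          rw [← vertexStep_innerDart hSD, ← vertexStep_innerDart hTE] at this
          exact this)
  refine ⟨l - j, ?_⟩
  rw [Diagram.fullDet, Diagram.fullDet, h1, h2, hj, hl, barSign_eq hSD, barSign_eq hTE, hb]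
  simp only [hbar]
  have : xPow l = xPow (l - j) * xPow j := by rw [← xPow_add, sub_add_cancel]
  rw [this]
  ring

/-! ### Independence of the code of a diagram. -/

section Iso

variable {D E : Diagram} {σ : Dart (Fin D.m) (Fin D.n) ≃ Dart (Fin E.m) (Fin E.n)}

theorem exists_point_of_isLeft_eq (hleft : ∀ d, (σ d).isLeft = d.isLeft) (p : Fin D.n)
    (i : Fin 2) : ∃ q j, σ (Sum.inr (p, i)) = Sum.inr (q, j) := by
  have := hleft (Sum.inr (p, i))
  rcases h : σ (Sum.inr (p, i)) with ⟨c, j⟩ | ⟨q, j⟩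
  · simp [h] at this
  · exact ⟨q, j, rfl⟩

theorem exists_crossing_of_isLeft_eq (hleft : ∀ d, (σ d).isLeft = d.isLeft) (c : Fin D.m)
    (i : Fin 4) : ∃ q j, σ (Sum.inl (c, i)) = Sum.inl (q, j) := by
  have := hleft (Sum.inl (c, i))
  rcases h : σ (Sum.inl (c, i)) with ⟨q, j⟩ | ⟨q, j⟩
  · exact ⟨q, j, rfl⟩
  · simp [h] at this

/-- Since `σ` commutes with `ccw`, the two darts of a point go to the two darts of a single point.
This induces a bijection `g` of points that matches the bars. -/
theorem barSign_eq_of_ccw (hccw : ∀ d, σ (ccw d) = ccw (σ d))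
    (hleft : ∀ d, (σ d).isLeft = d.isLeft) (hbar : ∀ d, E.atBar (σ d) = D.atBar d) :
    E.barSign = D.barSign := by
  choose g j hg using fun p => exists_point_of_isLeft_eq hleft p 0
  have hfin : ∀ i j : Fin 2, i = j ∨ i = j + 1 := by decide
  have h1 : ∀ p, σ (Sum.inr (p, 1)) = Sum.inr (g p, j p + 1) := fun p => by
    have := hccw (Sum.inr (p, 0))
    rwa [hg] at this
  refine (Fintype.prod_bijective g ⟨fun p q hpq => ?_, fun q => ?_⟩ _ _ fun p => ?_).symm
  · rcases hfin (j p) (j q) with h | h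
    · have : σ (Sum.inr (p, 0)) = σ (Sum.inr (q, 0)) := by rw [hg, hg, hpq, h]
      simpa using σ.injective this
    · have : σ (Sum.inr (p, 0)) = σ (Sum.inr (q, 1)) := by rw [hg, h1, hpq, h]
      simpa using σ.injective this
  · obtain ⟨d, hd⟩ := σ.surjective (Sum.inr (q, 0))
    have hl := hleft d
    rcases d with ⟨c, i⟩ | ⟨p, i⟩
    · simp [hd] at hl
    · refine ⟨p, ?_⟩
      rcases hfin i 0 with rfl | rfl
      · rw [hg] at hd
        simpa using (Prod.ext_iff.1 (Sum.inr_injective hd)).1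
      · rw [show (0 : Fin 2) + 1 = 1 from rfl, h1] at hd
        simpa using (Prod.ext_iff.1 (Sum.inr_injective hd)).1
  · have := hbar (Sum.inr (p, 0))
    rw [hg] at this
    simp only [Diagram.atBar] at this
    rw [this]

/-- Turning and going straight are rotations at a vertex, that is, iterates of `ccw`, and the sign
is read off from `isOver` and `out`. `isOver` enters only at real crossings, where `σ` preserves it.
-/
theorem transfer_of_iso (hccw : ∀ d, σ (ccw d) = ccw (σ d))
    (hleft : ∀ d, (σ d).isLeft = d.isLeft) (hreal : ∀ d, E.atReal (σ d) = D.atReal d)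
    (hbar : ∀ d, E.atBar (σ d) = D.atBar d)
    (hover : ∀ d, D.atReal d = true → isOver (σ d) = isOver d)
    (hlink : ∀ d, σ (D.link d) = E.link (σ d)) (hout : ∀ d, E.out (σ d) = D.out d)
    (w : Dart (Fin E.m) (Fin E.n) × Bool → LaurentXY) (d : Dart (Fin D.m) (Fin D.n)) (s : Bool) :
    E.transfer w (σ d, s) = D.transfer (fun a => w (σ a.1, a.2)) (d, s) := by
  cases ho : D.out d with
  | true =>
    rw [Diagram.transfer, step_apply_of_out _ _ _ ((hout d).trans ho), Diagram.transfer,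
      step_apply_of_out _ _ _ ho, hlink]
  | false =>
    rw [Diagram.transfer, step_apply_of_in _ _ _ ((hout d).trans ho), Diagram.transfer,
      step_apply_of_in _ _ _ ho]
    rcases d with ⟨c, i⟩ | ⟨p, i⟩
    · obtain ⟨q, j, hq⟩ := exists_crossing_of_isLeft_eq hleft c i
      have h1 : σ (Sum.inl (c, i + 1)) = Sum.inl (q, j + 1) := by
        have := hccw (Sum.inl (c, i))
        rwa [hq] at this
      have h2 : σ (Sum.inl (c, i + 2)) = Sum.inl (q, j + 2) := by
        have := hccw (Sum.inl (c, i + 1))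
        rw [h1] at this
        simpa [ccw, add_assoc] using this
      have h3 : σ (Sum.inl (c, i + 3)) = Sum.inl (q, j + 3) := by
        have := hccw (Sum.inl (c, i + 2))
        rw [h2] at this
        simpa [ccw, add_assoc] using this
      have hr : E.real q = D.real c := by simpa [hq, Diagram.atReal] using hreal (Sum.inl (c, i))
      have ho0 := hout (Sum.inl (c, i))
      have ho1 := hout (Sum.inl (c, i + 1))
      rw [hq] at ho0 ⊢
      rw [h1] at ho1
      simp only [vertexStep, hr, ho1]
      split_ifs with hc h
      · have hv := hover (Sum.inl (c, i)) hc
        rw [hq] at hv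
        simp only [signAt, ccw, hv, ho0, ho1, h1, h2]
      · have hv := hover (Sum.inl (c, i)) hc
        rw [hq] at hv
        simp only [signAt, ccw, hv, ho0, ho1, h3, h2]
      · rw [h2]
    · obtain ⟨q, j, hq⟩ := exists_point_of_isLeft_eq hleft p i
      have h1 : σ (Sum.inr (p, i + 1)) = Sum.inr (q, j + 1) := by
        have := hccw (Sum.inr (p, i))
        rwa [hq] at this
      have hb : E.bar q = D.bar p := by simpa [hq, Diagram.atBar] using hbar (Sum.inr (p, i))
      rw [hq]
      simp only [vertexStep, h1, hb]

/-- Diagrams with isomorphic codes have the same determinant. -/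
theorem Iso.fullDet_eq (h : Iso D E) : E.fullDet = D.fullDet := by
  obtain ⟨σ, hccw, hleft, hreal, hbar, hover, hlink, hout⟩ := h
  rw [Diagram.fullDet, Diagram.fullDet, barSign_eq_of_ccw hccw hleft hbar,
    ← Matrix.det_submatrix_equiv_self (σ.prodCongr (Equiv.refl Bool))
      (1 - LinearMap.toMatrix' E.transfer)]
  congr 2
  rw [Matrix.submatrix_sub, Pi.sub_apply, Pi.sub_apply, Matrix.submatrix_one_equiv]
  congr 1
  ext1 ⟨a, s⟩ ⟨b, t⟩
  have : (fun a : Dart (Fin D.m) (Fin D.n) × Bool =>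
      (Pi.single (σ b, t) 1 : _ → LaurentXY) (σ a.1, a.2)) = Pi.single (b, t) 1 := by
    funext ⟨a, u⟩
    simp [Pi.single_apply]
  have h2 := transfer_of_iso hccw hleft hreal hbar hover hlink hout (Pi.single (σ b, t) 1) a s
  rw [this] at h2
  simpa [LinearMap.toMatrix'_apply] using h2

end Iso

/-! ## Solvability of the equations for inner arcs -/

section Deps

variable {X J : Type} (real : X → Bool) (bar : J → Bool) (out : Dart X J → Bool)

/-- The darts whose values can contribute to the value at a dart entering a vertex. -/
def vertexDeps : Dart X J × Bool → List (Dart X J × Bool)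
  | (Sum.inr (p, i), s) => [(Sum.inr (p, i + 1), xor s (bar p))]
  | (Sum.inl (c, i), s) =>
    if real c && xor (isOver (Sum.inl (c, i) : Dart X J)) s then
      [(Sum.inl (c, i + 2), s),
        (Sum.inl (c, if out (Sum.inl (c, i + 1)) then i + 1 else i + 3), s)]
    else [(Sum.inl (c, i + 2), s)]

theorem turn_false (b : Bool) : turn b false = 0 := by cases b <;> rfl

/-- On the passive strand the turning coefficient vanishes, so only the opposite dart contributes.
This keeps the chains of dependencies from closing up around a bigon or triangle. -/
theorem vertexStep_eq_zero {v : Dart X J × Bool → LaurentXY} {a : Dart X J × Bool}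
    (h : ∀ q ∈ vertexDeps real bar out a, v q = 0) : vertexStep real bar out v a = 0 := by
  obtain ⟨⟨c, i⟩ | ⟨p, i⟩, s⟩ := a
  · simp only [vertexDeps] at h
    simp only [vertexStep]
    cases hr : real c
    · simp only [hr, Bool.false_and, Bool.false_eq_true, if_false] at h ⊢
      exact h _ (by simp)
    · cases ha : xor (isOver (Sum.inl (c, i) : Dart X J)) s
      · simp only [hr, ha, Bool.and_false, Bool.false_eq_true, if_false] at h
        rw [h _ (by simp)]
        simp [turn_false]
      · simp only [hr, ha, Bool.and_true, if_true] at h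
        rw [h (Sum.inl (c, i + 2), s) (by simp), h _ (List.mem_cons_of_mem _ (by simp))]
        simp
  · exact h _ (by simp [vertexDeps])

end Deps

/-- The orientation given by the directions of the darts `0` and `1` of the crossings and of the
darts `0` of the points, which are the binary digits of `a`, `b` and `c`. -/
def orientCode {m n : ℕ} (a b c : ℕ) : Dart (Fin m) (Fin n) → Bool
  | Sum.inl (x, 0) => a.testBit x
  | Sum.inl (x, 1) => b.testBit x
  | Sum.inl (x, 2) => !a.testBit x
  | Sum.inl (x, 3) => !b.testBit x
  | Sum.inr (p, 0) => c.testBit p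
  | Sum.inr (p, 1) => !c.testBit p

namespace Picture

variable {k : ℕ} (S : Picture k)

/-- A function that decreases along the dependencies of the values at inner arcs. -/
def Ranks (out : Dart (Fin S.m) (Fin S.n) → Bool) (r : Dart (Fin S.m) (Fin S.n) × Bool → ℕ) :
    Prop :=
  ∀ p, (∀ b, S.ends b ≠ p) → ∀ s,
    ∀ q ∈ (if out p then [(S.partner p, s)] else vertexDeps S.real S.bar out (p, s)),
      (∃ b, S.ends b = q.1) ∨ r q < r (p, s)

variable {S}

/-- Endpoints are not columns of the interior matrix, so the rank has to decrease only along
dependencies between interior darts; the matrix is then unipotent. -/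
theorem Ranks.interiorDet_eq_one {out : Dart (Fin S.m) (Fin S.n) → Bool}
    {r : Dart (Fin S.m) (Fin S.n) × Bool → ℕ} (h : S.Ranks out r) : S.interiorDet out = 1 := by
  refine Matrix.det_one_sub_eq_one_of_rank _ (fun a => r (a.1.1, a.2)) ?_
  rintro ⟨p, s⟩ ⟨q, t⟩ hr
  rw [LinearMap.toMatrix'_compress]
  have hp := h p.1 p.2 s
  have hz : ∀ a, (∃ b, S.ends b = a.1) ∨ r a < r (p.1, s) →
      (Pi.single (q.1, t) 1 : Dart (Fin S.m) (Fin S.n) × Bool → LaurentXY) a = 0 := by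
    rintro a (⟨b, hb⟩ | ha)
    · refine Pi.single_eq_of_ne ?_ _
      rintro rfl
      exact q.2 b hb
    · refine Pi.single_eq_of_ne ?_ _
      rintro rfl
      exact absurd ha (not_lt.2 hr)
  cases ho : out p.1 with
  | true =>
    simp only [transfer, step_apply_of_out _ _ _ ho]
    simp only [ho, if_true] at hp
    exact hz _ (hp _ (by simp))
  | false =>
    simp only [transfer, step_apply_of_in _ _ _ ho]
    simp only [ho, Bool.false_eq_true, if_false] at hp
    exact vertexStep_eq_zero _ _ _ fun a ha => hz a (hp a ha)

/-- One dart on each strand through a vertex determines the other by `out_opp`. Numbers as codes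
turn a quantifier over orientations into bounded ones that can be decided. -/
theorem Orients.exists_orientCode {out : Dart (Fin S.m) (Fin S.n) → Bool} (h : S.Orients out) :
    ∃ a < 2 ^ S.m, ∃ b < 2 ^ S.m, ∃ c < 2 ^ S.n, out = orientCode a b c := by
  refine ⟨Nat.ofBits fun c => out (Sum.inl (c, 0)), Nat.ofBits_lt_two_pow _,
    Nat.ofBits fun c => out (Sum.inl (c, 1)), Nat.ofBits_lt_two_pow _,
    Nat.ofBits fun p => out (Sum.inr (p, 0)), Nat.ofBits_lt_two_pow _, ?_⟩
  funext d
  rcases d with ⟨c, i⟩ | ⟨p, i⟩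
  · have h0 := h.out_opp (Sum.inl (c, 0))
    have h1 := h.out_opp (Sum.inl (c, 1))
    fin_cases i <;> simp [orientCode, Nat.testBit_ofBits_lt]
    · exact h0
    · exact h1
  · have h0 := h.out_opp (Sum.inr (p, 0))
    fin_cases i <;> simp [orientCode, Nat.testBit_ofBits_lt]
    exact h0

variable (S)

/-- The length of a chain of dependencies of the value at a dart, up to a bound. -/
def depth (out : Dart (Fin S.m) (Fin S.n) → Bool) : ℕ → Dart (Fin S.m) (Fin S.n) × Bool → ℕ
  | 0, _ => 0
  | n + 1, a =>
    if ∃ b, S.ends b = a.1 then 0 else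
      ((if out a.1 then [(S.partner a.1, a.2)] else vertexDeps S.real S.bar out a).map
        (fun q => depth out n q + 1)).foldr max 0

/-- An orientation that is compatible with the inner arcs. -/
def Fits (out : Dart (Fin S.m) (Fin S.n) → Bool) : Prop := ∀ a ∈ S.inner, out a.2 = !out a.1

instance (out) : Decidable (S.Fits out) := by unfold Fits; infer_instance

theorem solvable_of_depth (n : ℕ)
    (h : ∀ a < 2 ^ S.m, ∀ b < 2 ^ S.m, ∀ c < 2 ^ S.n, S.Fits (orientCode a b c) →
      S.Ranks (orientCode a b c) (S.depth (orientCode a b c) n)) :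
    S.Solvable := by
  intro out ho
  refine ⟨0, ?_⟩
  rw [xPow_zero]
  obtain ⟨a, ha, b, hb, c, hc, rfl⟩ := ho.exists_orientCode
  exact (h a ha b hb c hc ho.out_inner).interiorDet_eq_one

instance (out : Dart (Fin S.m) (Fin S.n) → Bool) (r : Dart (Fin S.m) (Fin S.n) × Bool → ℕ) :
    Decidable (S.Ranks out r) := by unfold Ranks; infer_instance

end Picture
/-! ## Symbolic solution of the equations for inner arcs -/

/-- A formal sum of terms `c * x ^ i * y ^ j * e`, where `e` is one of the unknowns `ε`. -/
abbrev LinForm (ε : Type) : Type := List (ℤ × ℤ × ℤ × ε)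

namespace LinForm

variable {ε : Type}

/-- The value of a formal sum. -/
noncomputable def eval (w : ε → LaurentXY) (l : LinForm ε) : LaurentXY :=
  (l.map fun t => t.1 • (xPow t.2.1 * yPow t.2.2.1 * w t.2.2.2)).sum

/-- The product with the monomial `c * x ^ i * y ^ j`. -/
def scale (c i j : ℤ) (l : LinForm ε) : LinForm ε :=
  l.map fun t => (c * t.1, i + t.2.1, j + t.2.2.1, t.2.2.2)

/-- All like terms cancel. -/
def IsNull [DecidableEq ε] (l : LinForm ε) : Prop :=
  ∀ t ∈ l, ((l.filter fun u => u.2 = t.2).map Prod.fst).sum = 0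

instance [DecidableEq ε] (l : LinForm ε) : Decidable l.IsNull := by
  unfold IsNull; infer_instance

theorem eval_append (w : ε → LaurentXY) (l l' : LinForm ε) :
    eval w (l ++ l') = eval w l + eval w l' := by
  simp [eval]

theorem eval_scale (w : ε → LaurentXY) (c i j : ℤ) (l : LinForm ε) :
    eval w (scale c i j l) = c • (xPow i * yPow j * eval w l) := by
  induction l with
  | nil => simp [eval, scale]
  | cons t l ih =>
    have h1 : eval w (scale c i j (t :: l)) = (c * t.1) •
        (xPow (i + t.2.1) * yPow (j + t.2.2.1) * w t.2.2.2) + eval w (scale c i j l) := rfl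
    have h2 : eval w (t :: l) = t.1 • (xPow t.2.1 * yPow t.2.2.1 * w t.2.2.2) + eval w l := rfl
    rw [h1, h2, ih, xPow_add, yPow_add]
    simp only [zsmul_eq_mul, Int.cast_mul]
    ring

/-- Evaluation factors through the finitely supported function `f` that collects the coefficients of
each monomial and unknown. `IsNull` tests its coefficients at the terms that occur, and all others
vanish anyway. -/
theorem eval_eq_zero [DecidableEq ε] {l : LinForm ε} (h : l.IsNull) (w : ε → LaurentXY) :
    eval w l = 0 := by
  let f : LinForm ε → (ℤ × ℤ × ε →₀ ℤ) := fun l => (l.map fun t => Finsupp.single t.2 t.1).sum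
  have hf : ∀ l, eval w l =
      Finsupp.linearCombination ℤ (fun t : ℤ × ℤ × ε => xPow t.1 * yPow t.2.1 * w t.2.2) (f l) := by
    intro l
    simp [f, eval, map_list_sum, Function.comp_def]
  have happ : ∀ (l : LinForm ε) k, f l k = ((l.filter fun u => u.2 = k).map Prod.fst).sum := by
    intro l k
    induction l with
    | nil => simp [f]
    | cons t l ih =>
      have h1 : f (t :: l) = Finsupp.single t.2 t.1 + f l := rfl
      rw [h1, Finsupp.add_apply, ih, Finsupp.single_apply, List.filter_cons]
      split_ifs <;> simp_all
  have h0 : f l = 0 := by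
    ext k
    rw [happ]
    by_cases hk : ∃ t ∈ l, t.2 = k
    · obtain ⟨t, ht, rfl⟩ := hk
      exact h t ht
    · have : (l.filter fun u => u.2 = k) = [] := by
        rw [List.filter_eq_nil_iff]
        intro t ht hc
        exact hk ⟨t, ht, by simpa using hc⟩
      simp [this]
  rw [hf, h0, map_zero]

end LinForm

section Symbolic

variable {X J ε : Type} (real : X → Bool) (bar : J → Bool) (out : Dart X J → Bool)

/-- The exponents of the coefficient for going straight on. -/
def straightExp : Bool → Bool → ℤ × ℤ
  | true, true => (0, 1)
  | true, false => (1, -1)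
  | false, true => (0, -1)
  | false, false => (-1, 1)

/-- Going straight costs minus a monomial, and an active turn costs 1 minus a power of x. Hence
integer coefficients and exponents suffice for the symbolic computation. -/
theorem straight_eq (b c : Bool) :
    straight b c = -(xPow (straightExp b c).1 * yPow (straightExp b c).2) := by
  cases b <;> cases c <;> simp [straight, straightExp, xPow_zero]

theorem turn_eq (b : Bool) : turn b true = 1 - xPow (if b then 1 else -1) := by
  cases b <;> rfl

/-- The symbolic version of `vertexStep`. -/
def symVertex (val : Dart X J × Bool → Option (LinForm ε)) : Dart X J × Bool → Option (LinForm ε)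
  | (Sum.inr (p, i), s) => val (Sum.inr (p, i + 1), xor s (bar p))
  | (Sum.inl (c, i), s) =>
    let d : Dart X J := Sum.inl (c, i)
    let e := straightExp (signAt out d) (xor (isOver d) s)
    if real c then
      match val (Sum.inl (c, i + 2), s) with
      | none => none
      | some l =>
        if xor (isOver d) s then
          match val (Sum.inl (c, if out (Sum.inl (c, i + 1)) then i + 1 else i + 3), s) with
          | none => none
          | some l' => some (l.scale (-1) e.1 e.2 ++ (l' ++
              l'.scale (-1) (if signAt out d then 1 else -1) 0))
        else some (l.scale (-1) e.1 e.2)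
    else val (Sum.inl (c, i + 2), s)

theorem symVertex_sound {val : Dart X J × Bool → Option (LinForm ε)}
    {v : Dart X J × Bool → LaurentXY} {w : ε → LaurentXY}
    (h : ∀ a l, val a = some l → v a = l.eval w) {a : Dart X J × Bool} {l : LinForm ε}
    (hl : symVertex real bar out val a = some l) : vertexStep real bar out v a = l.eval w := by
  obtain ⟨⟨c, i⟩ | ⟨p, i⟩, s⟩ := a
  · simp only [symVertex] at hl
    simp only [vertexStep]
    by_cases hr : real c = true
    · rw [if_pos hr] at hl ⊢
      cases h2 : val (Sum.inl (c, i + 2), s) with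
      | none => simp [h2] at hl
      | some l1 =>
        simp only [h2] at hl
        rw [h _ _ h2]
        by_cases ha : xor (isOver (Sum.inl (c, i) : Dart X J)) s = true
        · rw [if_pos ha] at hl
          cases h3 : val (Sum.inl (c, if out (Sum.inl (c, i + 1)) then i + 1 else i + 3), s) with
          | none => simp [h3] at hl
          | some l2 =>
            simp only [h3, Option.some.injEq] at hl
            rw [h _ _ h3, ← hl, LinForm.eval_append, LinForm.eval_append, LinForm.eval_scale,
              LinForm.eval_scale, straight_eq, ha, turn_eq, yPow_zero]
            simp only [neg_smul, one_smul]
            ring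
        · rw [if_neg ha, Option.some.injEq] at hl
          rw [Bool.not_eq_true] at ha
          rw [← hl, LinForm.eval_scale, straight_eq, ha, turn_false]
          simp only [neg_smul, one_smul]
          ring
    · rw [if_neg hr] at hl ⊢
      exact h _ _ hl
  · exact h _ _ hl

end Symbolic

namespace Picture

variable {k : ℕ} (S : Picture k)

/-- The endpoint at a dart. -/
def endAt (p : Dart (Fin S.m) (Fin S.n)) : Option (Fin k) :=
  (List.finRange k).find? fun b => S.ends b = p

/-- The value at a dart as a formal sum of values at endpoints, computed in at most `n` steps. -/
def symVal (out : Dart (Fin S.m) (Fin S.n) → Bool) :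
    ℕ → Dart (Fin S.m) (Fin S.n) × Bool → Option (LinForm (Fin k × Bool))
  | 0, _ => none
  | n + 1, a =>
    match S.endAt a.1 with
    | some b => some [(1, 0, 0, (b, a.2))]
    | none =>
      if out a.1 then symVal out n (S.partner a.1, a.2)
      else symVertex S.real S.bar out (symVal out n) a

-- In a solution, the equation of each interior dart can be substituted repeatedly until only
-- endpoints remain. If the `n` steps do not suffice the result is `none`, about which nothing is
-- claimed.
variable {S} in
theorem symVal_sound {out : Dart (Fin S.m) (Fin S.n) → Bool}
    {v : Dart (Fin S.m) (Fin S.n) × Bool → LaurentXY} (hv : S.IsSolution out v) (n : ℕ) :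
    ∀ a l, S.symVal out n a = some l → v a = l.eval fun e => v (S.ends e.1, e.2) := by
  induction n with
  | zero => intro a l h; simp [symVal] at h
  | succ n ih =>
    rintro ⟨p, s⟩ l h
    rw [symVal] at h
    cases he : S.endAt p with
    | some b =>
      simp only [he, Option.some.injEq] at h
      have hb : S.ends b = p := by simpa using List.find?_some he
      rw [← h, ← hb]
      simp [LinForm.eval, xPow_zero, yPow_zero]
    | none =>
      simp only [he] at h
      have hp : ∀ b, S.ends b ≠ p := by
        rw [endAt, List.find?_eq_none] at he
        intro b hb
        exact he b (List.mem_finRange b) (by simpa using hb)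
      rw [hv p hp s]
      cases ho : out p with
      | true =>
        simp only [ho, if_true] at h
        rw [transfer, step_apply_of_out _ _ _ ho]
        exact ih _ _ h
      | false =>
        simp only [ho, Bool.false_eq_true, if_false] at h
        rw [transfer, step_apply_of_in _ _ _ ho]
        exact symVertex_sound _ _ _ ih h

/-- Two formal sums are both defined and equal up to collecting like terms. -/
def sameForm {ε : Type} [DecidableEq ε] : Option (LinForm ε) → Option (LinForm ε) → Bool
  | some l, some l' => decide (LinForm.IsNull (l ++ LinForm.scale (-1) 0 0 l'))
  | _, _ => false

/-- The formal sums for the relations imposed by two oriented pictures agree. -/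
def SameForms (S T : Picture k) (outS : Dart (Fin S.m) (Fin S.n) → Bool)
    (outT : Dart (Fin T.m) (Fin T.n) → Bool) (n : ℕ) : Prop :=
  ∀ b, outS (S.ends b) = false → ∀ s,
    sameForm (symVertex S.real S.bar outS (S.symVal outS n) (S.ends b, s))
      (symVertex T.real T.bar outT (T.symVal outT n) (T.ends b, s)) = true

instance (S T : Picture k) (outS outT n) : Decidable (SameForms S T outS outT n) := by
  unfold SameForms; infer_instance

theorem SameForms.vertexStep_eq {S T : Picture k} {outS : Dart (Fin S.m) (Fin S.n) → Bool}
    {outT : Dart (Fin T.m) (Fin T.n) → Bool} {n : ℕ} (h : SameForms S T outS outT n)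
    {v : Dart (Fin S.m) (Fin S.n) × Bool → LaurentXY}
    {w : Dart (Fin T.m) (Fin T.n) × Bool → LaurentXY}
    (hv : S.IsSolution outS v) (hw : T.IsSolution outT w)
    (hvw : ∀ b s, v (S.ends b, s) = w (T.ends b, s)) {b : Fin k} (hb : outS (S.ends b) = false)
    (s : Bool) : vertexStep S.real S.bar outS v (S.ends b, s) =
      vertexStep T.real T.bar outT w (T.ends b, s) := by
  have h3 := h b hb s
  generalize hl : symVertex S.real S.bar outS (S.symVal outS n) (S.ends b, s) = ol at h3
  generalize hl' : symVertex T.real T.bar outT (T.symVal outT n) (T.ends b, s) = ol' at h3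
  rcases ol with _ | l <;> rcases ol' with _ | l' <;> try simp [sameForm] at h3
  rw [symVertex_sound _ _ _ (symVal_sound hv n) hl, symVertex_sound _ _ _ (symVal_sound hw n) hl']
  have h4 := LinForm.eval_eq_zero h3 fun e => v (S.ends e.1, e.2)
  rw [LinForm.eval_append, LinForm.eval_scale, xPow_zero, yPow_zero, one_mul, one_mul, neg_smul,
    one_smul, ← sub_eq_add_neg, sub_eq_zero] at h4
  rw [h4]
  simp only [hvw]

/-! ### Reduction of the hypotheses on pictures to finite checks. -/

instance : Decidable S.WellFormed :=
  have : ∀ a, Decidable (a ∈ S.inner) := fun a => decidable_of_iff (∃ b ∈ S.inner, b = a) (by simp)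
  decidable_of_iff ((∀ b c, S.ends b = S.ends c → b = c) ∧
    (∀ p, (∀ b, S.ends b ≠ p) → (p, S.partner p) ∈ S.inner ∨ (S.partner p, p) ∈ S.inner) ∧
    ∀ p, (∀ b, S.ends b ≠ p) → ∀ b, S.ends b ≠ S.partner p)
    ⟨fun h => ⟨h.1, h.2.1, h.2.2⟩, fun h => ⟨h.1, h.2, h.3⟩⟩

/-- Moves the sign to the integers, where equality can be decided by computation. -/
theorem barSign_eq_intCast :
    S.barSign = ((∏ p, if S.bar p then -1 else 1 : ℤ) : LaurentXY) := by
  rw [barSign, Int.cast_prod]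
  exact Finset.prod_congr rfl fun p _ => by split_ifs <;> simp

/-- The inner arcs of a picture pass a finite check, with chains of dependencies of length at
most `n`. -/
def Checked (n : ℕ) : Prop :=
  S.WellFormed ∧ ∀ a < 2 ^ S.m, ∀ b < 2 ^ S.m, ∀ c < 2 ^ S.n, S.Fits (orientCode a b c) →
    S.Ranks (orientCode a b c) (S.depth (orientCode a b c) n)

instance (n : ℕ) : Decidable (S.Checked n) := by unfold Checked; infer_instance

variable {S} in
theorem Checked.solvable {n : ℕ} (h : S.Checked n) : S.Solvable := S.solvable_of_depth n h.2

/-- For a given orientation of `S`, and all compatible ones of `T`, the two pictures impose the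
same relation, as seen by formal sums. -/
def CheckedAgainst (S T : Picture k) (n : ℕ) (out : Dart (Fin S.m) (Fin S.n) → Bool) : Prop :=
  ∀ a < 2 ^ T.m, ∀ b < 2 ^ T.m, ∀ c < 2 ^ T.n,
    (∀ e, out (S.ends e) = orientCode a b c (T.ends e)) → T.Fits (orientCode a b c) →
      SameForms S T out (orientCode a b c) n

instance (S T : Picture k) (n out) : Decidable (CheckedAgainst S T n out) := by
  unfold CheckedAgainst; infer_instance

/-- Two pictures pass a finite check for imposing the same relation. -/
def CheckedPair (S T : Picture k) (n : ℕ) : Prop :=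
  (∏ p, if S.bar p then -1 else 1 : ℤ) = (∏ p, if T.bar p then -1 else 1 : ℤ) ∧
    ∀ a < 2 ^ S.m, ∀ b < 2 ^ S.m, ∀ c < 2 ^ S.n, S.Fits (orientCode a b c) →
      CheckedAgainst S T n (orientCode a b c)

instance (S T : Picture k) (n : ℕ) : Decidable (CheckedPair S T n) := by
  unfold CheckedPair; infer_instance

theorem CheckedPair.sameRelation {S T : Picture k} {n : ℕ} (h : CheckedPair S T n) :
    S.SameRelation T := by
  intro outS outT hS hT hends v w hv hw hvw e he s
  obtain ⟨a, ha, b, hb, c, hc, rfl⟩ := hS.exists_orientCode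
  obtain ⟨a', ha', b', hb', c', hc', rfl⟩ := hT.exists_orientCode
  exact (h.2 a ha b hb c hc hS.out_inner a' ha' b' hb' c' hc' hends hT.out_inner).vertexStep_eq
    hv hw hvw he s

end Picture

theorem Replace.fullDet_eq_of_checked {k : ℕ} {S T : Picture k} {D E : Diagram}
    (h : Replace S T D E) (n : ℕ) (hS : S.Checked n) (hT : T.Checked n)
    (hST : Picture.CheckedPair S T n) : ∃ m : ℤ, E.fullDet = xPow m * D.fullDet :=
  h.fullDet_eq hS.1 hT.1 hS.solvable hT.solvable
    (by rw [S.barSign_eq_intCast, T.barSign_eq_intCast, hST.1])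
    hST.sameRelation

open Picture

/-! ## The moves -/

/-- The Yang–Baxter computation for all orientations. The condition `hs` excludes the two patterns
in which the three lines lie cyclically over each other. -/
theorem triangle_checked (s : Fin 3 → Fin 4) (h : ∀ c, s c = 0 ∨ s c = 1)
    (hs : s 1 = s 0 ∨ s 1 = s 2) :
    (triangleBelow (fun _ => true) s).Checked 8 ∧ (triangleAbove (fun _ => true) s).Checked 8 ∧
      CheckedPair (triangleBelow (fun _ => true) s) (triangleAbove (fun _ => true) s) 8 := by
  -- Boolean offsets leave only eight cases to enumerate, before the condition on heights is
  -- imposed.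
  have key : ∀ t : Fin 3 → Bool, t 1 = t 0 ∨ t 1 = t 2 →
      (triangleBelow (fun _ => true) fun c => if t c then 1 else 0).Checked 8 ∧
      (triangleAbove (fun _ => true) fun c => if t c then 1 else 0).Checked 8 ∧
      CheckedPair (triangleBelow (fun _ => true) fun c => if t c then 1 else 0)
        (triangleAbove (fun _ => true) fun c => if t c then 1 else 0) 8 := by
    decide +kernel
  have hst : s = fun c => if decide (s c = 1) then 1 else 0 := by
    funext c
    rcases h c with h | h <;> simp [h]
  rw [hst]
  exact key (fun c => decide (s c = 1)) (hs.imp (fun h => by rw [h]) fun h => by rw [h])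

theorem fullDet_eq_of_crossing_crossingWithPoint {D E : Diagram} (r : Bool) (i : Fin 4)
    (h : Replace (crossing r) (crossingWithPoint r false i) D E) :
    ∃ m : ℤ, E.fullDet = xPow m * D.fullDet := by
  have key : ∀ (r : Bool) (i : Fin 4), (crossing r).Checked 4 ∧
      (crossingWithPoint r false i).Checked 4 ∧
      CheckedPair (crossing r) (crossingWithPoint r false i) 4 := by decide +kernel
  obtain ⟨h1, h2, h3⟩ := key r i
  exact h.fullDet_eq_of_checked 4 h1 h2 h3

theorem fullDet_eq_of_mixed_triangle {D E : Diagram} (s : Fin 4) (hs : s = 0 ∨ s = 1)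
    (h : Replace (triangleBelow ![false, false, true] ![0, 0, s])
      (triangleAbove ![false, false, true] ![0, 0, s]) D E) :
    ∃ m : ℤ, E.fullDet = xPow m * D.fullDet := by
  rcases hs with rfl | rfl <;>
    exact h.fullDet_eq_of_checked 8 (by decide +kernel) (by decide +kernel) (by decide +kernel)

/-- Seen from the endpoints, the over-strand of one picture is the under-strand of the other. The
bars exchange the sheets at the crossing, so the same strand is active on both sides; the sign of
the crossing is also the same. -/
theorem fullDet_eq_of_barredCrossing {D E : Diagram} (s : Fin 4) (hs : s = 0 ∨ s = 1)
    (h : Replace (barredCrossing s) (virtualStack s) D E) :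
    ∃ m : ℤ, E.fullDet = xPow m * D.fullDet := by
  rcases hs with rfl | rfl <;>
    exact h.fullDet_eq_of_checked 8 (by decide +kernel) (by decide +kernel) (by decide +kernel)

/-! ### Real curls -/

/-- The only interior unknowns are those at the ends `p`, `q` of the loop. With zero values at the
endpoints, the equations on sheet `s` are v(p) = v(q) and v(q) = t(s) v(p), of determinant 1 - t(s).
-/
theorem Picture.interiorDet_of_loop {k : ℕ} {S : Picture k}
    {out : Dart (Fin S.m) (Fin S.n) → Bool} {p q : S.Interior} (hpq : p ≠ q)
    (hall : ∀ d : S.Interior, d = p ∨ d = q) (hop : out p.1 = true) (hoq : out q.1 = false)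
    (hpart : S.partner p.1 = q.1) (t : Bool → LaurentXY)
    (ht : ∀ w s, (∀ b s, w (S.ends b, s) = 0) →
      vertexStep S.real S.bar out w (q.1, s) = t s * w (p.1, s)) :
    S.interiorDet out = (1 - t false) * (1 - t true) := by
  have hbij : Function.Bijective
      (![(p, false), (q, false), (p, true), (q, true)] : Fin 4 → S.Interior × Bool) := by
    constructor
    · intro i j hij
      fin_cases i <;> fin_cases j <;> simp [hpq, hpq.symm] at hij ⊢
    · rintro ⟨d, s⟩
      rcases hall d with rfl | rfl <;> cases s
      · exact ⟨0, rfl⟩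
      · exact ⟨2, rfl⟩
      · exact ⟨1, rfl⟩
      · exact ⟨3, rfl⟩
  have hz : ∀ (d : S.Interior) (u : Bool) b s,
      (Pi.single (d.1, u) 1 : Dart (Fin S.m) (Fin S.n) × Bool → LaurentXY) (S.ends b, s) = 0 :=
    fun d u b s => Pi.single_eq_of_ne (fun h => d.2 b (Prod.ext_iff.1 h).1) _
  have h1 : ∀ (d : S.Interior) u s, S.transfer out (Pi.single (d.1, u) 1) (p.1, s) =
      if q = d ∧ s = u then 1 else 0 := fun d u s => by
    rw [transfer, step_apply_of_out _ _ _ hop, hpart]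
    simp [Pi.single_apply, Subtype.ext_iff]
  have h2 : ∀ (d : S.Interior) u s, S.transfer out (Pi.single (d.1, u) 1) (q.1, s) =
      if p = d ∧ s = u then t s else 0 := fun d u s => by
    rw [transfer, step_apply_of_in _ _ _ hoq, ht _ _ (hz d u)]
    simp [Pi.single_apply, Subtype.ext_iff]
  rw [interiorDet, ← Matrix.det_submatrix_equiv_self (Equiv.ofBijective _ hbij)]
  have : (1 - LinearMap.toMatrix' ((S.transfer out).compress
      fun a : S.Interior × Bool => (a.1.1, a.2))).submatrix
      (Equiv.ofBijective _ hbij) (Equiv.ofBijective _ hbij) =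
      !![1, -1, 0, 0; -t false, 1, 0, 0; 0, 0, 1, -1; 0, 0, -t true, 1] := by
    ext1 i j
    rw [Matrix.submatrix_apply, Matrix.sub_apply, LinearMap.toMatrix'_compress]
    fin_cases i <;> fin_cases j <;> simp [h1, h2, hpq, hpq.symm]
  rw [this]
  simp [Matrix.det_succ_row_zero, Fin.sum_univ_succ, Fin.succAbove]
  ring

/-- The turn is active on exactly one sheet, where 1 - (1 - x) = x, or likewise with the inverse of
x; the other sheet contributes 1. This is the source of the power of x in the theorem. -/
theorem loop_factor (b c : Bool) :
    (1 - turn b c) * (1 - turn b !c) = xPow (if b then 1 else -1) := by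
  cases b <;> cases c <;> simp [turn]

/-- The darts of a curl. -/
def curlDart (s i : Fin 4) : Dart (Fin (curl true s).m) (Fin (curl true s).n) :=
  Sum.inl ((0 : Fin 1), i)

theorem curl_ends_ne_two : ∀ s b, (curl true s).ends b ≠ curlDart s (s + 2) := by decide +kernel

theorem curl_ends_ne_three : ∀ s b, (curl true s).ends b ≠ curlDart s (s + 3) := by decide +kernel

theorem curl_interior : ∀ s p, (∀ b, (curl true s).ends b ≠ p) →
    p = curlDart s (s + 2) ∨ p = curlDart s (s + 3) := by decide +kernel

theorem curl_partner_two : ∀ s, (curl true s).partner (curlDart s (s + 2)) = curlDart s (s + 3) := by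
  decide +kernel

theorem curl_partner_three :
    ∀ s, (curl true s).partner (curlDart s (s + 3)) = curlDart s (s + 2) := by
  decide +kernel

theorem curlDart_ne : ∀ s, curlDart s (s + 2) ≠ curlDart s (s + 3) := by decide +kernel

theorem vertexStep_curl (s : Fin 4) (out : Dart (Fin (curl true s).m) (Fin (curl true s).n) → Bool)
    (w : Dart (Fin (curl true s).m) (Fin (curl true s).n) × Bool → LaurentXY) (i : Fin 4)
    (u : Bool) :
    vertexStep (curl true s).real (curl true s).bar out w (curlDart s i, u) =
      straight (signAt out (curlDart s i)) (xor (isOver (curlDart s i)) u) *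
          w (curlDart s (i + 2), u) +
        turn (signAt out (curlDart s i)) (xor (isOver (curlDart s i)) u) *
          w (curlDart s (if out (curlDart s (i + 1)) then i + 1 else i + 3), u) :=
  rfl

theorem curl_out (s : Fin 4) {out : Dart (Fin (curl true s).m) (Fin (curl true s).n) → Bool}
    (ho : (curl true s).Orients out) :
    out (curlDart s s) = !out (curlDart s (s + 2)) ∧
      out (curlDart s (s + 1)) = out (curlDart s (s + 2)) ∧
      out (curlDart s (s + 3)) = !out (curlDart s (s + 2)) := by
  have h0 : out (curlDart s (s + 2)) = !out (curlDart s s) := ho.out_opp (curlDart s s)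
  have h1 : out (curlDart s (s + 1 + 2)) = !out (curlDart s (s + 1)) :=
    ho.out_opp (curlDart s (s + 1))
  have h2 : out (curlDart s (s + 3)) = !out (curlDart s (s + 2)) :=
    ho.out_inner _ (List.mem_singleton_self _)
  rw [show s + 1 + 2 = s + 3 by rw [add_assoc]; rfl] at h1
  rw [h2] at h1
  simp_all

theorem curl_solvable (s : Fin 4) : (curl true s).Solvable := by
  intro out ho
  obtain ⟨h0, h1, h3⟩ := curl_out s ho
  have hall : ∀ d : (curl true s).Interior, d = ⟨_, curl_ends_ne_two s⟩ ∨
      d = ⟨_, curl_ends_ne_three s⟩ := fun d =>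
    (curl_interior s d.1 d.2).imp Subtype.ext Subtype.ext
  have hne : (⟨_, curl_ends_ne_two s⟩ : (curl true s).Interior) ≠ ⟨_, curl_ends_ne_three s⟩ :=
    fun h => curlDart_ne s (congrArg Subtype.val h)
  cases h2 : out (curlDart s (s + 2)) with
  | true =>
    rw [h2] at h0 h1 h3
    refine ⟨if signAt out (curlDart s (s + 3)) then 1 else -1,
      (interiorDet_of_loop hne hall h2 h3 (curl_partner_two s)
      (fun u => turn (signAt out (curlDart s (s + 3))) (xor (isOver (curlDart s (s + 3))) u))
      fun w u hw => ?_).trans ?_⟩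
    -- Going straight from the loop leaves the picture, so only the turn back into the loop
    -- survives.
    · have e1 : w (curlDart s (s + 1), u) = 0 := hw 1 u
      rw [vertexStep_curl, add_assoc, add_assoc, add_assoc, show (3 + 1 : Fin 4) = 0 from rfl,
        show (3 + 2 : Fin 4) = 1 from rfl, show (3 + 3 : Fin 4) = 2 from rfl, add_zero, h0, e1]
      simp
    · simp only [Bool.xor_false, Bool.xor_true, loop_factor]
  | false =>
    rw [h2] at h0 h1 h3
    refine ⟨if signAt out (curlDart s (s + 2)) then 1 else -1,
      (interiorDet_of_loop hne.symm (fun d => (hall d).symm) h3 h2 (curl_partner_three s)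
      (fun u => turn (signAt out (curlDart s (s + 2))) (xor (isOver (curlDart s (s + 2))) u))
      fun w u hw => ?_).trans ?_⟩
    · have e1 : w (curlDart s s, u) = 0 := hw 0 u
      rw [vertexStep_curl, add_assoc, add_assoc, add_assoc, show (2 + 1 : Fin 4) = 3 from rfl,
        show (2 + 2 : Fin 4) = 0 from rfl, add_zero, h3, e1]
      simp
    · simp only [Bool.xor_false, Bool.xor_true, loop_factor]

/-- Here `p` is the value on the loop and `r` the value after the curl. The two straight
coefficients multiply to x or its inverse, and the active turn is 1 minus the same power. Whether
the active passage comes first or second, the curl passes the value on unchanged. -/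
theorem curl_relation (b c : Bool) {p r : LaurentXY} (h : p = straight b c * r + turn b c * p) :
    straight b (!c) * p + turn b (!c) * r = r := by
  have hx := xPow_mul_neg 1
  have hy := yPow_mul_neg 1
  cases b <;> cases c <;> simp only [straight, turn, Bool.not_true, Bool.not_false] at h ⊢ <;>
    grind

theorem curl_isOver : ∀ s, isOver (curlDart s s) = !isOver (curlDart s (s + 3)) := by decide

theorem curl_isOver_one : ∀ s, isOver (curlDart s (s + 1)) = !isOver (curlDart s (s + 2)) := by
  decide

theorem curl_sameRelation (s : Fin 4) : (arc false).SameRelation (curl true s) := by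
  intro outS outT hS hT hends v w hv hw hvw e he t
  have hv0 : vertexStep (arc false).real (arc false).bar outS v ((arc false).ends 0, t) =
      w (curlDart s (s + 1), t) := by
    have : v (Sum.inr ((0 : Fin 1), 1), t) = w (curlDart s (s + 1), t) := hvw 1 t
    rw [← this]
    simp [vertexStep, arc]
  have hv1 : vertexStep (arc false).real (arc false).bar outS v ((arc false).ends 1, t) =
      w (curlDart s s, t) := by
    have : v (Sum.inr ((0 : Fin 1), 0), t) = w (curlDart s s, t) := hvw 0 t
    rw [← this]
    simp [vertexStep, arc]
  obtain ⟨h0, h1, h3⟩ := curl_out s hT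
  have hw2 := hw _ (curl_ends_ne_two s) t
  have hw3 := hw _ (curl_ends_ne_three s) t
  rw [hends] at he
  fin_cases e
  · change outT (curlDart s s) = false at he
    have h2 : outT (curlDart s (s + 2)) = true := by rw [he] at h0; simpa using h0.symm
    rw [h2] at h1 h3
    -- The sign of the crossing is the same when computed at either of its two incoming darts.
    have hs0 : signAt outT (curlDart s s) = signAt outT (curlDart s (s + 3)) := by
      have : ccw (curlDart s (s + 3)) = curlDart s s := by
        change curlDart s (s + 3 + 1) = _
        rw [add_assoc, show (3 + 1 : Fin 4) = 0 from rfl, add_zero]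
      have h' : ccw (curlDart s s) = curlDart s (s + 1) := rfl
      rw [signAt, signAt, this, h', he, h1, h3, curl_isOver]
      simp
    rw [transfer, step_apply_of_out _ _ _ h2, curl_partner_two] at hw2
    rw [transfer, step_apply_of_in _ _ _ h3, vertexStep_curl, add_assoc, add_assoc, add_assoc,
      show (3 + 1 : Fin 4) = 0 from rfl, show (3 + 2 : Fin 4) = 1 from rfl,
      show (3 + 3 : Fin 4) = 2 from rfl, add_zero, he, if_neg Bool.false_ne_true, hw2] at hw3
    refine hv0.trans ?_
    change _ = vertexStep _ _ _ _ (curlDart s s, t)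
    rw [vertexStep_curl, h1, if_pos rfl, hw2, hs0, curl_isOver, Bool.not_xor]
    exact (curl_relation _ _ hw3).symm
  · change outT (curlDart s (s + 1)) = false at he
    have h2 : outT (curlDart s (s + 2)) = false := by rw [← h1, he]
    rw [h2] at h0 h3
    have hs0 : signAt outT (curlDart s (s + 1)) = signAt outT (curlDart s (s + 2)) := by
      have h : ccw (curlDart s (s + 1)) = curlDart s (s + 2) := by
        change curlDart s (s + 1 + 1) = _
        rw [add_assoc]
        rfl
      have h' : ccw (curlDart s (s + 2)) = curlDart s (s + 3) := by
        change curlDart s (s + 2 + 1) = _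
        rw [add_assoc]
        rfl
      rw [signAt, signAt, h, h', he, h2, h3, curl_isOver_one]
      simp
    rw [transfer, step_apply_of_out _ _ _ h3, curl_partner_three] at hw3
    rw [transfer, step_apply_of_in _ _ _ h2, vertexStep_curl, add_assoc, add_assoc, add_assoc,
      show (2 + 1 : Fin 4) = 3 from rfl, show (2 + 2 : Fin 4) = 0 from rfl, add_zero, h3,
      Bool.not_false, if_pos rfl, hw3] at hw2
    refine hv1.trans ?_
    change _ = vertexStep _ _ _ _ (curlDart s (s + 1), t)
    rw [vertexStep_curl, add_assoc, add_assoc, add_assoc, show (1 + 1 : Fin 4) = 2 from rfl,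
      show (1 + 2 : Fin 4) = 3 from rfl, show (1 + 3 : Fin 4) = 0 from rfl, add_zero, h2,
      if_neg Bool.false_ne_true, hw3, hs0, curl_isOver_one, Bool.not_xor]
    exact (curl_relation _ _ hw2).symm

theorem fullDet_eq_of_curl {D E : Diagram} (s : Fin 4) (hs : s = 0 ∨ s = 1)
    (h : Replace (arc false) (curl true s) D E) :
    ∃ m : ℤ, E.fullDet = xPow m * D.fullDet :=
  h.fullDet_eq (by decide +kernel) (by rcases hs with rfl | rfl <;> decide +kernel)
    (solvable_of_depth _ 2 (by decide +kernel)) (curl_solvable s)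
    (by
      rw [barSign_eq_intCast, barSign_eq_intCast]
      exact congrArg _ (by rcases hs with rfl | rfl <;> decide +kernel))
    (curl_sameRelation s)

/-! ### Invariance under all moves. -/

/-- A move multiplies the determinant by a power of `x`. -/
theorem Move.fullDet_eq {D E : Diagram} (h : Move D E) :
    ∃ m : ℤ, E.fullDet = xPow m * D.fullDet := by
  cases h with
  | iso h => exact ⟨0, by rw [xPow_zero, one_mul, h.fullDet_eq]⟩
  | pointOnArc b h =>
    cases b <;>
      exact h.fullDet_eq_of_checked 4 (by decide +kernel) (by decide +kernel) (by decide +kernel)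
  | pointAtCrossing r i h => exact fullDet_eq_of_crossing_crossingWithPoint r i h
  | R1 s hs h => exact fullDet_eq_of_curl s hs h
  | R2 h =>
    exact h.fullDet_eq_of_checked 6 (by decide +kernel) (by decide +kernel) (by decide +kernel)
  | R3 s h01 hs h =>
    obtain ⟨h1, h2, h3⟩ := triangle_checked s h01 hs
    exact h.fullDet_eq_of_checked 8 h1 h2 h3
  | V1 h =>
    exact h.fullDet_eq_of_checked 4 (by decide +kernel) (by decide +kernel) (by decide +kernel)
  | V2 h =>
    exact h.fullDet_eq_of_checked 6 (by decide +kernel) (by decide +kernel) (by decide +kernel)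
  | V3 h =>
    exact h.fullDet_eq_of_checked 8 (by decide +kernel) (by decide +kernel) (by decide +kernel)
  | V4 s hs h => exact fullDet_eq_of_mixed_triangle s hs h
  | T1 h =>
    exact h.fullDet_eq_of_checked 4 (by decide +kernel) (by decide +kernel) (by decide +kernel)
  | T2 h =>
    exact h.fullDet_eq_of_checked 4 (by decide +kernel) (by decide +kernel) (by decide +kernel)
  | T3 s hs h => exact fullDet_eq_of_barredCrossing s hs h

theorem Equivalent.fullDet_eq {D E : Diagram} (h : Equivalent D E) :
    ∃ m : ℤ, E.fullDet = xPow m * D.fullDet := by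
  induction h with
  | rel _ _ h => exact h.fullDet_eq
  | refl => exact ⟨0, by rw [xPow_zero, one_mul]⟩
  | symm D E _ ih =>
    obtain ⟨m, hm⟩ := ih
    refine ⟨-m, ?_⟩
    rw [hm, ← mul_assoc, ← xPow_add, neg_add_cancel, xPow_zero, one_mul]
  | trans D E F _ _ ih ih' =>
    obtain ⟨m, hm⟩ := ih
    obtain ⟨n, hn⟩ := ih'
    exact ⟨n + m, by rw [hn, hm, xPow_add, mul_assoc]⟩

/-! ## Diagrams without free circles -/

theorem opp_opp {X J : Type} (d : Dart X J) : opp (opp d) = d := by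
  rcases d with ⟨c, i⟩ | ⟨p, i⟩
  · have : ∀ i : Fin 4, i + 2 + 2 = i := by decide
    simp [opp, this]
  · have : ∀ i : Fin 2, i + 1 + 1 = i := by decide
    simp [opp, this]

namespace Diagram

variable {D : Diagram}

theorem atReal_opp (d : Dart (Fin D.m) (Fin D.n)) : D.atReal (opp d) = D.atReal d := by
  rcases d with ⟨c, i⟩ | ⟨p, i⟩ <;> rfl

theorem atBar_opp (d : Dart (Fin D.m) (Fin D.n)) : D.atBar (opp d) = D.atBar d := by
  rcases d with ⟨c, i⟩ | ⟨p, i⟩ <;> rfl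

theorem Path.cons {d e : Dart (Fin D.m) (Fin D.n)} {k : ℕ} (h : D.Path (opp (D.link d)) e k)
    (hd : D.atReal (D.link d) = false) :
    D.Path d e (k + if D.atBar (D.link d) then 1 else 0) := by
  induction h with
  | start => simpa using Path.pass Path.start hd
  | pass h he ih => simpa [add_right_comm] using Path.pass ih he

theorem Path.eq_or_cons {d e : Dart (Fin D.m) (Fin D.n)} {k : ℕ} (h : D.Path d e k) :
    (e = D.link d ∧ k = 0) ∨ (D.atReal (D.link d) = false ∧ ∃ j, D.Path (opp (D.link d)) e j ∧
      k = j + if D.atBar (D.link d) then 1 else 0) := by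
  induction h with
  | start => exact Or.inl ⟨rfl, rfl⟩
  | pass h he ih =>
    rcases ih with ⟨rfl, rfl⟩ | ⟨hr, j, hj, rfl⟩
    · exact Or.inr ⟨he, 0, Path.start, rfl⟩
    · exact Or.inr ⟨hr, _, Path.pass hj he, by rw [add_right_comm]⟩

/-- Strands can be followed backwards through the same vertices. This will show that distinct edges
of |D| have distinct ends. -/
theorem Path.reverse {d e : Dart (Fin D.m) (Fin D.n)} {k : ℕ} (h : D.Path d e k) :
    D.Path e d k := by
  induction h with
  | start => simpa [D.link_link] using (Path.start (D := D) (d := D.link d))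
  | @pass e k h he ih =>
    have h1 : D.link (D.link (opp e)) = opp e := D.link_link _
    have := Path.cons (d := D.link (opp e)) (e := d) (k := k) (by rwa [h1, opp_opp])
      (by rwa [h1, atReal_opp])
    rwa [h1, atBar_opp] at this

theorem Path.out_eq {d e : Dart (Fin D.m) (Fin D.n)} {k : ℕ} (h : D.Path d e k) :
    D.out e = !D.out d := by
  induction h with
  | start => exact D.out_link d
  | pass h he ih => rw [D.out_link, D.out_opp, ih, Bool.not_not]

theorem Path.compare {d e e' : Dart (Fin D.m) (Fin D.n)} {k k' : ℕ} (h : D.Path d e k)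
    (h' : D.Path d e' k') (he' : D.atReal e' = true) :
    (e = e' ∧ k = k') ∨ (D.atReal e = false ∧ ∃ j, D.Path (opp e) e' j) := by
  -- Following a strand is deterministic, so a path that reaches a real crossing extends every other
  -- path from the same dart. The bar count is carried along only for the induction.
  have key : (e = e' ∧ k = k') ∨ (D.atReal e = false ∧ ∃ j, D.Path (opp e) e' j ∧
      k' = k + ((if D.atBar e then 1 else 0) + j)) := by
    induction h with
    | start =>
      rcases h'.eq_or_cons with ⟨rfl, rfl⟩ | ⟨hr, j, hj, rfl⟩
      · exact Or.inl ⟨rfl, rfl⟩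
      · exact Or.inr ⟨hr, j, hj, by ring⟩
    | pass h he ih =>
      rcases ih with ⟨rfl, rfl⟩ | ⟨hr, j, hj, rfl⟩
      · rw [he] at he'
        contradiction
      · rcases hj.eq_or_cons with ⟨rfl, rfl⟩ | ⟨hr', j', hj', rfl⟩
        · exact Or.inl ⟨rfl, by ring⟩
        · exact Or.inr ⟨hr', j', hj', by ring⟩
  exact key.imp id fun ⟨h1, j, hj, _⟩ => ⟨h1, j, hj⟩

theorem Path.unique {d e e' : Dart (Fin D.m) (Fin D.n)} {k k' : ℕ} (h : D.Path d e k)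
    (he : D.atReal e = true) (h' : D.Path d e' k') (he' : D.atReal e' = true) :
    e = e' ∧ k = k' := by
  rcases h.compare h' he' with h1 | ⟨h1, _⟩
  · exact h1
  · rw [he] at h1
    contradiction

theorem Path.exists_iterate {d e : Dart (Fin D.m) (Fin D.n)} {k : ℕ} (h : D.Path d e k) :
    ∃ n, e = D.link ((fun d => opp (D.link d))^[n] d) := by
  induction h with
  | start => exact ⟨0, rfl⟩
  | pass h he ih =>
    obtain ⟨n, rfl⟩ := ih
    exact ⟨n + 1, by rw [Function.iterate_succ_apply']⟩

/-- A function that decreases along a strand until a real crossing is met. -/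
theorem NoFreeCircle.exists_rank (hD : D.NoFreeCircle) :
    ∃ N : Dart (Fin D.m) (Fin D.n) → ℕ,
      ∀ d, D.atReal (D.link d) = false → N (opp (D.link d)) < N d := by
  classical
  have hex : ∀ d, ∃ n, D.atReal (D.link ((fun d => opp (D.link d))^[n] d)) = true := fun d => by
    obtain ⟨e, k, h, he⟩ := hD d
    obtain ⟨n, rfl⟩ := h.exists_iterate
    exact ⟨n, he⟩
  refine ⟨fun d => Nat.find (hex d), fun d hd => ?_⟩
  have h1 := Nat.find_spec (hex d)
  cases hn : Nat.find (hex d) with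
  | zero => rw [hn] at h1; simp [hd] at h1
  | succ n =>
    rw [hn, Function.iterate_succ_apply] at h1
    change Nat.find (hex (opp (D.link d))) < Nat.find (hex d)
    rw [hn]
    exact Nat.lt_succ_of_le (Nat.find_min' (hex (opp (D.link d))) h1)

/-- The values of a solution do not change along the edges of `|D|`, except that bars exchange the
sheets. -/
theorem Path.solution_eq {d e : Dart (Fin D.m) (Fin D.n)} {k : ℕ} (h : D.Path d e k)
    (hd : D.out d = true) {v : Dart (Fin D.m) (Fin D.n) × Bool → LaurentXY}
    (hv : ∀ d s, (D.atReal d = true → D.out d = true) → v (d, s) = D.transfer v (d, s))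
    (s : Bool) : v (d, s) = v (e, xor s (decide (Odd k))) := by
  induction h with
  | start =>
    rw [hv d s fun _ => hd, transfer, step_apply_of_out _ _ _ hd]
    simp
  | @pass e k h he ih =>
    have ho : D.out e = false := by rw [h.out_eq, hd]; rfl
    have ho' : D.out (opp e) = true := by rw [D.out_opp, ho]; rfl
    have h1 : ∀ u, v (e, u) = v (opp e, xor u (D.atBar e)) := fun u => by
      rw [hv e u fun hr => by rw [he] at hr; contradiction, transfer, step_apply_of_in _ _ _ ho]
      rcases e with ⟨c, i⟩ | ⟨p, i⟩
      · have hc : D.real c = false := he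
        simp [vertexStep, hc, opp, atBar]
      · rfl
    rw [ih, h1, hv _ _ fun _ => ho', transfer, step_apply_of_out _ _ _ ho']
    congr 2
    rw [Bool.xor_assoc]
    congr 1
    cases D.atBar e <;> by_cases hk : Odd k <;> simp [Nat.odd_add_one, hk]

/-! ### Corners of real crossings and their labels. -/

variable (D)

/-- At every crossing there is a dart leaving it to the right. -/
theorem exists_outRight (c : Fin D.m) :
    ∃ i : Fin 4, D.out (Sum.inl (c, i)) = true ∧ D.out (Sum.inl (c, i + 1)) = true := by
  have h0 : D.out (Sum.inl (c, 2)) = !D.out (Sum.inl (c, 0)) := D.out_opp (Sum.inl (c, 0))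
  have h1 : D.out (Sum.inl (c, 3)) = !D.out (Sum.inl (c, 1)) := D.out_opp (Sum.inl (c, 1))
  cases ha : D.out (Sum.inl (c, 0)) <;> cases hb : D.out (Sum.inl (c, 1)) <;> rw [ha] at h0 <;>
    rw [hb] at h1
  · exact ⟨2, h0, h1⟩
  · exact ⟨1, hb, h0⟩
  · exact ⟨3, h1, ha⟩
  · exact ⟨0, ha, hb⟩

/-- The number of the dart leaving a crossing to the right. -/
noncomputable def outRight (c : Fin D.m) : Fin 4 := (D.exists_outRight c).choose

theorem out_outRight (c : Fin D.m) :
    D.out (Sum.inl (c, D.outRight c)) = true ∧ D.out (Sum.inl (c, D.outRight c + 1)) = true ∧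
      D.out (Sum.inl (c, D.outRight c + 2)) = false ∧
      D.out (Sum.inl (c, D.outRight c + 3)) = false := by
  obtain ⟨h0, h1⟩ := (D.exists_outRight c).choose_spec
  have h2 := D.out_opp (Sum.inl (c, D.outRight c))
  have h3 := D.out_opp (Sum.inl (c, D.outRight c + 1))
  refine ⟨h0, h1, ?_, ?_⟩
  · change D.out (opp (Sum.inl (c, D.outRight c))) = false
    rw [h2]
    exact congrArg not h0
  · have : opp (Sum.inl (c, D.outRight c + 1) : Dart (Fin D.m) (Fin D.n)) =
        Sum.inl (c, D.outRight c + 3) := by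
      simp only [opp, add_assoc]
      rfl
    rw [← this, h3]
    exact congrArg not h1

/-- The ends of edges of `|D|` at real crossings: a real crossing and `false` for left, `true` for
right. -/
abbrev Corner : Type := D.RealCrossing × Bool

variable {D}

/-- The dart entering a real crossing from the left or from the right. -/
noncomputable def inDart (e : D.Corner) : Dart (Fin D.m) (Fin D.n) :=
  Sum.inl (e.1.1, D.outRight e.1.1 + if e.2 then 3 else 2)

/-- The dart leaving a real crossing to the left or to the right. -/
noncomputable def outDart (e : D.Corner) : Dart (Fin D.m) (Fin D.n) :=
  Sum.inl (e.1.1, D.outRight e.1.1 + if e.2 then 0 else 1)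

theorem out_inDart (e : D.Corner) : D.out (inDart e) = false := by
  obtain ⟨c, l⟩ := e
  obtain ⟨h0, h1, h2, h3⟩ := D.out_outRight c.1
  cases l
  · exact h2
  · exact h3

theorem out_outDart (e : D.Corner) : D.out (outDart e) = true := by
  obtain ⟨c, l⟩ := e
  obtain ⟨h0, h1, h2, h3⟩ := D.out_outRight c.1
  cases l
  · exact h1
  · simpa [outDart] using h0

theorem atReal_inDart (e : D.Corner) : D.atReal (inDart e) = true := e.1.2

theorem atReal_outDart (e : D.Corner) : D.atReal (outDart e) = true := e.1.2

theorem inDart_injective : Function.Injective (inDart (D := D)) := by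
  rintro ⟨⟨c, hc⟩, l⟩ ⟨⟨c', hc'⟩, l'⟩ h
  simp only [inDart, Sum.inl.injEq, Prod.mk.injEq] at h
  obtain ⟨rfl, h⟩ := h
  rw [add_right_inj] at h
  cases l <;> cases l' <;> first | rfl | simp at h

theorem outDart_injective : Function.Injective (outDart (D := D)) := by
  rintro ⟨⟨c, hc⟩, l⟩ ⟨⟨c', hc'⟩, l'⟩ h
  simp only [outDart, Sum.inl.injEq, Prod.mk.injEq] at h
  obtain ⟨rfl, h⟩ := h
  rw [add_right_inj] at h
  cases l <;> cases l' <;> first | rfl | simp at h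

theorem exists_outRight_add (c : Fin D.m) (i : Fin 4) :
    i = D.outRight c + 0 ∨ i = D.outRight c + 1 ∨ i = D.outRight c + 2 ∨ i = D.outRight c + 3 := by
  generalize D.outRight c = j
  revert i j
  decide

theorem exists_inDart_eq {d : Dart (Fin D.m) (Fin D.n)} (hr : D.atReal d = true)
    (ho : D.out d = false) : ∃ e, inDart e = d := by
  rcases d with ⟨c, i⟩ | ⟨p, i⟩
  · obtain ⟨h0, h1, h2, h3⟩ := D.out_outRight c
    rcases exists_outRight_add c i with rfl | rfl | rfl | rfl
    · rw [add_zero, h0] at ho; contradiction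
    · rw [h1] at ho; contradiction
    · exact ⟨(⟨c, hr⟩, false), rfl⟩
    · exact ⟨(⟨c, hr⟩, true), rfl⟩
  · simp [atReal] at hr

theorem exists_outDart_eq {d : Dart (Fin D.m) (Fin D.n)} (hr : D.atReal d = true)
    (ho : D.out d = true) : ∃ e, outDart e = d := by
  rcases d with ⟨c, i⟩ | ⟨p, i⟩
  · obtain ⟨h0, h1, h2, h3⟩ := D.out_outRight c
    rcases exists_outRight_add c i with rfl | rfl | rfl | rfl
    · exact ⟨(⟨c, hr⟩, true), rfl⟩
    · exact ⟨(⟨c, hr⟩, false), rfl⟩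
    · rw [h2] at ho; contradiction
    · rw [h3] at ho; contradiction
  · simp [atReal] at hr

/-- The label of a corner. -/
def cornerLabel (l : Bool) : Fin 4 := if l then 1 else 0

theorem label_inDart (e : D.Corner) : D.label (inDart e) = cornerLabel e.2 := by
  obtain ⟨c, l⟩ := e
  obtain ⟨h0, h1, h2, h3⟩ := D.out_outRight c.1
  cases l
  · have : ccw (inDart (c, false)) = Sum.inl (c.1, D.outRight c.1 + 3) := by
      simp only [ccw, inDart, add_assoc]
      rfl
    rw [label, this, h3]
    rfl
  · have : ccw (inDart (c, true)) = Sum.inl (c.1, D.outRight c.1) := by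
      simp only [ccw, inDart, add_assoc]
      simp
    rw [label, this, h0]
    rfl

theorem label_outDart (e : D.Corner) : D.label (outDart e) = cornerLabel e.2 := by
  obtain ⟨c, l⟩ := e
  obtain ⟨h0, h1, h2, h3⟩ := D.out_outRight c.1
  cases l
  · have : ccw (outDart (c, false)) = Sum.inl (c.1, D.outRight c.1 + 2) := by
      simp only [ccw, outDart, add_assoc]
      rfl
    rw [label, this, h2]
    rfl
  · have : ccw (outDart (c, true)) = Sum.inl (c.1, D.outRight c.1 + 1) := by
      simp only [ccw, outDart, add_assoc]
      simp
    rw [label, this, h1]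
    rfl

theorem arrowWith_iff (k : ℕ) (i : D.RealCrossing) (a : Fin 4) (j : D.RealCrossing) (b : Fin 4) :
    D.ArrowWith k i a j b ↔ ∃ l l', cornerLabel l = a ∧ cornerLabel l' = b ∧
      D.Path (outDart (j, l')) (inDart (i, l)) k := by
  constructor
  · rintro ⟨s, t, hs, ha, ht, hb, h⟩
    obtain ⟨⟨i', l⟩, he⟩ := exists_inDart_eq (d := Sum.inl (i.1, s)) i.2 hs
    obtain ⟨⟨j', l'⟩, he'⟩ := exists_outDart_eq (d := Sum.inl (j.1, t)) j.2 ht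
    obtain rfl : i' = i := Subtype.ext (Prod.ext_iff.1 (Sum.inl_injective he)).1
    obtain rfl : j' = j := Subtype.ext (Prod.ext_iff.1 (Sum.inl_injective he')).1
    rw [← he, label_inDart] at ha
    rw [← he', label_outDart] at hb
    rw [← he, ← he'] at h
    exact ⟨l, l', ha, hb, h⟩
  · rintro ⟨l, l', rfl, rfl, h⟩
    exact ⟨_, _, out_inDart (i, l), label_inDart (i, l), out_outDart (j, l'),
      label_outDart (j, l'), h⟩

theorem isPositive_iff (c : D.RealCrossing) :
    D.IsPositive c.1 ↔ isOver (outDart (c, true)) = true := by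
  obtain ⟨h0, h1, h2, h3⟩ := D.out_outRight c.1
  have hj : ∀ j : Fin 4, j + 1 + 1 = j + 2 ∧ j + 2 + 1 = j + 3 ∧ j + 3 + 1 = j := by decide
  obtain ⟨e1, e2, e3⟩ := hj (D.outRight c.1)
  constructor
  · rintro ⟨i, hi, hi', hover⟩
    simp only [ccw] at hi'
    rcases exists_outRight_add c.1 i with rfl | rfl | rfl | rfl
    · exact hover
    · rw [e1, h2] at hi'; contradiction
    · rw [h2] at hi; contradiction
    · rw [h3] at hi; contradiction
  · intro h
    exact ⟨D.outRight c.1, h0, h1, by simpa [outDart] using h⟩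

/-! ### The edges of `|D|` -/

theorem NoFreeCircle.exists_edge (hD : D.NoFreeCircle) (e : D.Corner) :
    ∃ (e' : D.Corner) (k : ℕ), D.Path (outDart e) (inDart e') k := by
  obtain ⟨d, k, h, hd⟩ := hD (outDart e)
  obtain ⟨e', rfl⟩ := exists_inDart_eq hd (by rw [h.out_eq, out_outDart]; rfl)
  exact ⟨e', k, h⟩

/-- The other end of the edge that leaves a real crossing at a given corner. -/
noncomputable def edgeEnd (hD : D.NoFreeCircle) (e : D.Corner) : D.Corner :=
  (hD.exists_edge e).choose

/-- The number of bars on the edge that leaves a real crossing at a given corner. -/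
noncomputable def edgeBars (hD : D.NoFreeCircle) (e : D.Corner) : ℕ :=
  (hD.exists_edge e).choose_spec.choose

theorem path_edge (hD : D.NoFreeCircle) (e : D.Corner) :
    D.Path (outDart e) (inDart (edgeEnd hD e)) (edgeBars hD e) :=
  (hD.exists_edge e).choose_spec.choose_spec

theorem path_outDart_inDart_iff (hD : D.NoFreeCircle) (e e' : D.Corner) (k : ℕ) :
    D.Path (outDart e) (inDart e') k ↔ e' = edgeEnd hD e ∧ k = edgeBars hD e := by
  constructor
  · intro h
    obtain ⟨h1, h2⟩ := h.unique (atReal_inDart _) (path_edge hD e) (atReal_inDart _)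
    exact ⟨inDart_injective h1, h2⟩
  · rintro ⟨rfl, rfl⟩
    exact path_edge hD e

/-- An edge followed backwards from its incoming end reaches a unique outgoing corner; injectivity
suffices on a finite set. -/
theorem edgeEnd_bijective (hD : D.NoFreeCircle) : Function.Bijective (edgeEnd hD) := by
  refine Finite.injective_iff_bijective.1 fun e e' h => ?_
  have h1 := (path_edge hD e).reverse
  have h2 := (path_edge hD e').reverse
  rw [← h] at h2
  exact outDart_injective (h1.unique (atReal_outDart _) h2 (atReal_outDart _)).1

/-- The parity of the number of bars, as a sign, is multiplicative over the edges of `|D|`. -/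
theorem prod_edgeBars (hD : D.NoFreeCircle) :
    ∏ e, (-1 : ℤ) ^ edgeBars hD e = ∏ p, if D.bar p then -1 else 1 := by
  classical
  have hD' := hD
  choose en kn hpath hreal using hD'
  -- `F` is the sign of the bars ahead of an outgoing dart up to the next real crossing, `A` and `B`
  -- are its parts at real crossings and elsewhere. `C` records each bar once, at its outgoing dart.
  let F : Dart (Fin D.m) (Fin D.n) → ℤ := fun d => if D.out d then (-1) ^ kn d else 1
  let A : Dart (Fin D.m) (Fin D.n) → ℤ := fun d => if D.atReal d then F d else 1
  let B : Dart (Fin D.m) (Fin D.n) → ℤ := fun d => if D.atReal d then 1 else F d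
  let C : Dart (Fin D.m) (Fin D.n) → ℤ := fun d => if D.out d then
    (if D.atBar d then -1 else 1) else 1
  let θ : Equiv.Perm (Dart (Fin D.m) (Fin D.n)) :=
    { toFun := fun d => opp (D.link d)
      invFun := fun d => D.link (opp d)
      left_inv := fun d => by simp only [opp_opp, D.link_link]
      right_inv := fun d => by simp only [opp_opp, D.link_link] }
  -- The bars ahead of `d` are the one at the next vertex, if any, and those ahead of that vertex.
  -- At a real crossing the count stops, since `B` and `C` are 1 there.
  have hθ : ∀ d, F d = C (θ d) * B (θ d) := by
    intro d
    have ho : D.out (θ d) = D.out d := by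
      change D.out (opp (D.link d)) = _
      rw [D.out_opp, D.out_link, Bool.not_not]
    have hr : D.atReal (θ d) = D.atReal (D.link d) := atReal_opp _
    have hb : D.atBar (θ d) = D.atBar (D.link d) := atBar_opp _
    cases hd : D.out d with
    | false => simp [F, B, C, ho, hd]
    | true =>
      cases hl : D.atReal (D.link d) with
      | true =>
        have hk : kn d = 0 := ((hpath d).unique (hreal d) Path.start hl).2
        have hbar : D.atBar (D.link d) = false := by
          generalize D.link d = e at hl
          rcases e with ⟨c, i⟩ | ⟨p, i⟩
          · rfl
          · simp [atReal] at hl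
        simp [F, B, C, ho, hd, hr, hl, hb, hk, hbar]
      | false =>
        have hk : kn d = kn (θ d) + if D.atBar (D.link d) then 1 else 0 :=
          ((hpath d).unique (hreal d) (Path.cons (hpath (θ d)) hl) (hreal _)).2
        simp only [F, B, C, ho, hd, hr, hl, hb, hk, if_true, Bool.false_eq_true, if_false]
        cases D.atBar (D.link d) <;> simp [pow_succ]
  have hAB : ∀ d, F d = A d * B d := fun d => by
    cases hr : D.atReal d <;> simp [A, B, hr]
  have hB : (∏ d, B d) * ∏ d, B d = 1 := by
    rw [← Finset.prod_mul_distrib]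
    refine Finset.prod_eq_one fun d _ => ?_
    simp only [B, F]
    split_ifs <;> simp [← mul_pow]
  -- Both sides are the product of all `F d`, the second one reindexed by `θ`. The product of `B`
  -- squares to 1 and cancels, leaving the bars.
  have h1 : (∏ d, A d) * ∏ d, B d = (∏ d, C d) * ∏ d, B d := by
    rw [← Finset.prod_mul_distrib, ← Finset.prod_mul_distrib,
      ← Equiv.prod_comp θ (fun d => C d * B d)]
    exact Finset.prod_congr rfl fun d _ => by rw [← hAB, hθ]
  have hAC : ∏ d, A d = ∏ d, C d := by
    have := congrArg (· * ∏ d, B d) h1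
    simpa only [mul_assoc, hB, mul_one] using this
  have hA : ∏ e, (-1 : ℤ) ^ edgeBars hD e = ∏ d, A d := by
    refine Fintype.prod_of_injective outDart outDart_injective _ _ (fun d hd => ?_) fun e => ?_
    · simp only [A, F]
      split_ifs with hr ho
      · exact absurd (exists_outDart_eq hr ho) fun ⟨e, he⟩ => hd ⟨e, he⟩
      · rfl
      · rfl
    · have := ((hpath (outDart e)).unique (hreal _) (path_edge hD e) (atReal_inDart _)).2
      simp only [A, F, atReal_outDart, out_outDart, if_true, this]
  have hC : ∏ d, C d = ∏ p, if D.bar p then -1 else 1 := by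
    rw [Fintype.prod_sum_type, Fintype.prod_prod_type, Fintype.prod_prod_type]
    have : ∏ x : Fin D.m, ∏ y : Fin 4, C (Sum.inl (x, y)) = 1 :=
      Finset.prod_eq_one fun x _ => Finset.prod_eq_one fun y _ => by simp [C, atBar]
    rw [this, one_mul]
    refine Finset.prod_congr rfl fun p _ => ?_
    rw [Fin.prod_univ_two]
    have ho : D.out (Sum.inr (p, 1)) = !D.out (Sum.inr (p, 0)) := D.out_opp (Sum.inr (p, 0))
    cases hp : D.out (Sum.inr (p, 0)) <;> simp [C, ho, hp, atBar] <;> rfl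
  rw [← hC, ← hAC, ← hA]

/-! ### The matrix `matP` as a permutation of corners on two sheets. -/

/-- The index of a corner on one of the sheets in the matrices `M̃` and `P̃`. -/
def cornerCode (l s : Bool) : Fin 4 := if s then (cornerLabel l).rev else cornerLabel l

theorem cornerCode_bijective : Function.Bijective fun x : Bool × Bool => cornerCode x.1 x.2 := by
  decide

/-- The identification of the index sets for the corners on both sheets. -/
noncomputable def cornerEquiv : D.Corner × Bool ≃ D.RealCrossing × Fin 4 :=
  (Equiv.prodAssoc _ _ _).trans
    ((Equiv.refl _).prodCongr (Equiv.ofBijective _ cornerCode_bijective))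

theorem cornerEquiv_apply (c : D.RealCrossing) (l s : Bool) :
    cornerEquiv ((c, l), s) = (c, cornerCode l s) := rfl

/-- The permutation of the corners on both sheets that is given by the edges of `|D|`. -/
noncomputable def edgePerm (hD : D.NoFreeCircle) : Equiv.Perm (D.Corner × Bool) :=
  (Equiv.prodCongrRight fun e =>
      if Odd (edgeBars hD e) then Equiv.boolNot else Equiv.refl Bool).trans
    (Equiv.prodCongrLeft fun _ => Equiv.ofBijective _ (edgeEnd_bijective hD))

theorem edgePerm_apply (hD : D.NoFreeCircle) (e : D.Corner) (s : Bool) :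
    edgePerm hD (e, s) = (edgeEnd hD e, xor s (decide (Odd (edgeBars hD e)))) := by
  by_cases h : Odd (edgeBars hD e) <;> simp [edgePerm, h]

/-- The permutation of corners acts equally on both sheets, so its sign is squared away. Each edge
with an odd number of bars contributes one transposition of sheets. -/
theorem sign_edgePerm (hD : D.NoFreeCircle) :
    ((Equiv.Perm.sign (edgePerm hD) : ℤ) : LaurentXY) = D.barSign := by
  have h1 : Equiv.Perm.sign (edgePerm hD) =
      ∏ e, Equiv.Perm.sign (if Odd (edgeBars hD e) then Equiv.boolNot else Equiv.refl Bool) := by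
    rw [edgePerm, Equiv.Perm.sign_trans, Equiv.Perm.sign_prodCongrRight,
      Equiv.Perm.sign_prodCongrLeft]
    simp
  have hnot : Equiv.Perm.sign Equiv.boolNot = -1 := by decide
  have h2 : (Equiv.Perm.sign (edgePerm hD) : ℤ) = ∏ e, (-1 : ℤ) ^ edgeBars hD e := by
    rw [h1, Units.coe_prod]
    refine Finset.prod_congr rfl fun e _ => ?_
    by_cases h : Odd (edgeBars hD e)
    · rw [if_pos h, hnot, h.neg_one_pow]
      rfl
    · rw [if_neg h, (Nat.not_odd_iff_even.1 h).neg_one_pow]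
      exact congrArg Units.val Equiv.Perm.sign_refl
  rw [h2, prod_edgeBars, barSign, Int.cast_prod]
  exact Finset.prod_congr rfl fun p _ => by split_ifs <;> simp

theorem evenArrow_iff (hD : D.NoFreeCircle) (i : D.RealCrossing) (a : Fin 4) (j : D.RealCrossing)
    (b : Fin 4) : D.EvenArrow i a j b ↔ ∃ l l', cornerLabel l = a ∧ cornerLabel l' = b ∧
      (i, l) = edgeEnd hD (j, l') ∧ ¬Odd (edgeBars hD (j, l')) := by
  simp only [EvenArrow, arrowWith_iff, path_outDart_inDart_iff hD]
  constructor
  · rintro ⟨k, hk, l, l', ha, hb, h1, rfl⟩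
    exact ⟨l, l', ha, hb, h1, Nat.not_odd_iff_even.2 hk⟩
  · rintro ⟨l, l', ha, hb, h1, h2⟩
    exact ⟨_, Nat.not_odd_iff_even.1 h2, l, l', ha, hb, h1, rfl⟩

theorem oddArrow_iff (hD : D.NoFreeCircle) (i : D.RealCrossing) (a : Fin 4) (j : D.RealCrossing)
    (b : Fin 4) : D.OddArrow i a j b ↔ ∃ l l', cornerLabel l = a ∧ cornerLabel l' = b ∧
      (i, l) = edgeEnd hD (j, l') ∧ Odd (edgeBars hD (j, l')) := by
  simp only [OddArrow, arrowWith_iff, path_outDart_inDart_iff hD]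
  constructor
  · rintro ⟨k, hk, l, l', ha, hb, h1, rfl⟩
    exact ⟨l, l', ha, hb, h1, hk⟩
  · rintro ⟨l, l', ha, hb, h1, h2⟩
    exact ⟨_, h2, l, l', ha, hb, h1, rfl⟩

/-- Reversed labels mark the sheet `true`. The four alternatives in `matP` are then the four pairs
of sheets for row and column: even edges keep the sheet, odd edges switch it. The transpose appears
because rows index the incoming ends. -/
theorem matP_eq (hD : D.NoFreeCircle) :
    D.matP.submatrix cornerEquiv cornerEquiv = ((edgePerm hD).permMatrix LaurentXY).transpose := by
  classical
  ext1 ⟨⟨i, l⟩, s⟩ ⟨⟨j, l'⟩, s'⟩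
  rw [Matrix.submatrix_apply, Matrix.transpose_apply, Equiv.Perm.permMatrix,
    PEquiv.toMatrix_apply, matP, Matrix.of_apply]
  simp only [cornerEquiv_apply, Equiv.toPEquiv_apply, Option.mem_def, Option.some.injEq,
    edgePerm_apply]
  refine if_congr ?_ rfl rfl
  have hlab : ∀ m l s : Bool, (cornerLabel m = cornerCode l s ↔ m = l ∧ s = false) ∧
      (cornerLabel m = (cornerCode l s).rev ↔ m = l ∧ s = true) := by decide
  simp only [evenArrow_iff hD, oddArrow_iff hD, (hlab _ _ _).1, (hlab _ _ _).2]
  by_cases h : Odd (edgeBars hD (j, l')) <;> cases s <;> cases s' <;>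
    simp [h, eq_comm]

/-! ### Elimination down to the darts entering real crossings. -/

/-- The darts on both sheets that do not enter a real crossing. -/
abbrev Inner (D : Diagram) : Type :=
  {x : Dart (Fin D.m) (Fin D.n) × Bool // D.atReal x.1 = true → D.out x.1 = true}

theorem bijective_inDart_inner : Function.Bijective
    (Sum.elim (fun a : D.Corner × Bool => (inDart a.1, a.2)) (Subtype.val : D.Inner → _)) := by
  constructor
  · refine Function.Injective.sumElim ?_ Subtype.val_injective ?_
    · rintro ⟨e, s⟩ ⟨e', s'⟩ h
      simp only [Prod.mk.injEq] at h
      rw [inDart_injective h.1, h.2]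
    · rintro ⟨e, s⟩ ⟨x, hx⟩ rfl
      have := hx (atReal_inDart e)
      rw [out_inDart] at this
      exact absurd this (by decide)
  · rintro ⟨d, s⟩
    by_cases h : D.atReal d = true → D.out d = true
    · exact ⟨Sum.inr ⟨(d, s), h⟩, rfl⟩
    · simp only [Classical.not_imp, Bool.not_eq_true] at h
      obtain ⟨e, rfl⟩ := exists_inDart_eq h.1 h.2
      exact ⟨Sum.inl (e, s), rfl⟩

theorem transfer_apply_of_out {d : Dart (Fin D.m) (Fin D.n)} (h : D.out d = true) (s : Bool)
    (v : Dart (Fin D.m) (Fin D.n) × Bool → LaurentXY) :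
    D.transfer v (d, s) = v (D.link d, s) :=
  step_apply_of_out _ _ _ h s v

theorem transfer_apply_of_in {d : Dart (Fin D.m) (Fin D.n)} (h : D.out d = false)
    (hr : D.atReal d = false) (s : Bool) (v : Dart (Fin D.m) (Fin D.n) × Bool → LaurentXY) :
    D.transfer v (d, s) = v (opp d, xor s (D.atBar d)) := by
  rw [transfer, step_apply_of_in _ _ _ h]
  rcases d with ⟨c, i⟩ | ⟨p, i⟩
  · have hc : D.real c = false := hr
    simp [vertexStep, hc, opp, atBar]
  · simp [vertexStep, opp, atBar]

/-- The eliminated equations follow a strand forwards and stop on entering a real crossing. As there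
is no free circle this always happens, so they form a unipotent system. -/
theorem NoFreeCircle.det_inner (hD : D.NoFreeCircle) :
    (1 - LinearMap.toMatrix' (D.transfer.compress (Subtype.val : D.Inner → _))).det = 1 := by
  obtain ⟨N, hN⟩ := hD.exists_rank
  -- Along a strand, out and in darts alternate: 2N + 1 at an outgoing dart, one more at the
  -- incoming dart before it. The strict decrease of N across an arc leaves room for this. The value
  -- 0 belongs to darts that are not eliminated.
  let r : Dart (Fin D.m) (Fin D.n) → ℕ := fun d =>
    if D.out d then 2 * N d + 1 else if D.atReal d then 0 else 2 * N (opp d) + 2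
  refine Matrix.det_one_sub_eq_one_of_rank _ (fun a => r a.1.1) ?_
  rintro ⟨⟨d, s⟩, hd⟩ ⟨⟨e, t⟩, he⟩ hab
  rw [LinearMap.toMatrix'_compress]
  change r d ≤ r e at hab
  change D.transfer (Pi.single (e, t) 1) (d, s) = 0
  cases ho : D.out d with
  | true =>
    rw [transfer_apply_of_out ho, Pi.single_apply, if_neg]
    intro h
    simp only [Prod.mk.injEq] at h
    obtain ⟨rfl, -⟩ := h
    have hol : D.out (D.link d) = false := by rw [D.out_link, ho]; rfl
    have hr : D.atReal (D.link d) = false := by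
      by_contra h
      have := he (by simpa using h)
      rw [hol] at this
      exact absurd this (by decide)
    have := hN d hr
    simp only [r, ho, hol, hr, if_true, Bool.false_eq_true, if_false] at hab
    omega
  | false =>
    have hr : D.atReal d = false := by
      by_contra h
      have := hd (by simpa using h)
      rw [ho] at this
      exact absurd this (by decide)
    rw [transfer_apply_of_in ho hr, Pi.single_apply, if_neg]
    intro h
    simp only [Prod.mk.injEq] at h
    obtain ⟨rfl, -⟩ := h
    have hol : D.out (opp d) = true := by rw [D.out_opp, ho]; rfl
    simp only [r, ho, hol, hr, if_true, Bool.false_eq_true, if_false] at hab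
    omega

-- `straight` and `turn` were chosen as the entries of the blocks. On the sheet `true` the reversed
-- labels exchange left and right, so the same block makes the under-strand active there instead of
-- the over-strand.
set_option maxHeartbeats 800000 in
theorem transfer_inDart (v : Dart (Fin D.m) (Fin D.n) × Bool → LaurentXY) (a : D.Corner × Bool) :
    D.transfer v (inDart a.1, a.2) =
      (D.matM.submatrix cornerEquiv cornerEquiv).mulVec (fun b => v (outDart b.1, b.2)) a := by
  classical
  obtain ⟨⟨c, l⟩, s⟩ := a
  have hsum : (D.matM.submatrix cornerEquiv cornerEquiv).mulVec
      (fun b => v (outDart b.1, b.2)) ((c, l), s) =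
      ∑ l', ∑ s', (if D.IsPositive c.1 then blockPos else blockNeg)
        (cornerCode l s) (cornerCode l' s') * v (outDart (c, l'), s') := by
    rw [Matrix.mulVec, dotProduct, Fintype.sum_prod_type, Fintype.sum_prod_type,
      Finset.sum_eq_single c]
    · refine Finset.sum_congr rfl fun l' _ => Finset.sum_congr rfl fun s' _ => ?_
      rw [Matrix.submatrix_apply, cornerEquiv_apply, cornerEquiv_apply, matM, Matrix.of_apply]
      split_ifs <;> simp_all
    · intro c' _ hc'
      refine Finset.sum_eq_zero fun l' _ => Finset.sum_eq_zero fun s' _ => ?_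
      rw [Matrix.submatrix_apply, cornerEquiv_apply, cornerEquiv_apply, matM, Matrix.of_apply,
        if_neg (Ne.symm hc'), zero_mul]
    · simp
  rw [hsum, transfer, step_apply_of_in _ _ _ (out_inDart _)]
  have h := D.out_outRight c.1
  have hp := isPositive_iff c
  have hc : D.real c.1 = true := c.2
  simp only [inDart, outDart, vertexStep, hc, if_true, hp]
  clear hsum hp
  generalize D.outRight c.1 = i at h ⊢
  obtain ⟨h0, h1, h2, h3⟩ := h
  -- The numbering of darts can start at any of four positions relative to the orientation; side and
  -- sheet are then checked against the block entries.
  fin_cases i <;> cases l <;> cases s <;>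
    simp_all [signAt, isOver, ccw, cornerCode, cornerLabel, straight, turn, blockPos, blockNeg] <;>
    exact add_comm _ _

/-- Elimination leaves `τ` = MU: a value entering a real crossing is M applied to the outgoing
values, and these are carried along the edges by U from the incoming ones. Multiplying M - `matP` by
the permutation matrix U then turns it into -(1 - `τ`). -/
theorem NoFreeCircle.ztilde_eq_fullDet (hD : D.NoFreeCircle) : D.Ztilde = D.fullDet := by
  obtain ⟨τ, hdet, hτ⟩ := D.transfer.exists_eliminate _ _ bijective_inDart_inner
    (by rw [hD.det_inner]; exact isUnit_one)
  rw [hD.det_inner, one_mul] at hdet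
  let M := D.matM.submatrix cornerEquiv cornerEquiv
  let U := (edgePerm hD).permMatrix LaurentXY
  have hτM : τ = M * U := by
    refine Matrix.ext_of_mulVec_single fun b => ?_
    obtain ⟨v, hv1, hv2, hv3⟩ := hτ (Pi.single b 1)
    funext a
    rw [← hv3, transfer_inDart, ← Matrix.mulVec_mulVec, Matrix.permMatrix_mulVec]
    congr 2
    funext ⟨e, s⟩
    rw [(path_edge hD e).solution_eq (out_outDart e) (fun d s h => hv2 ⟨(d, s), h⟩), Function.comp,
      edgePerm_apply]
    exact hv1 (_, _)
  have hUU : U.transpose * U = 1 := by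
    rw [Matrix.transpose_permMatrix, ← Matrix.permMatrix_mul]
    simp
  have hmul : (M - U.transpose) * U = -(1 - τ) := by
    rw [Matrix.sub_mul, hUU, hτM, neg_sub]
  have hU : U.det = D.barSign := by rw [← sign_edgePerm hD, Matrix.det_permutation]
  have hUsq : D.barSign * D.barSign = 1 := by
    have := congrArg Matrix.det hUU
    rwa [Matrix.det_mul, Matrix.det_transpose, Matrix.det_one, hU] at this
  have hZ : D.Ztilde = (M - U.transpose).det := by
    rw [Ztilde, ← Matrix.det_submatrix_equiv_self cornerEquiv, Matrix.submatrix_sub,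
      ← matP_eq hD]
    rfl
  have hd := congrArg Matrix.det hmul
  -- The two sheets make the size even, so the sign of -(1 - `τ`) does not matter.
  have heven : Even (Fintype.card (D.Corner × Bool)) := by
    simp [Fintype.card_prod]
  rw [Matrix.det_mul, Matrix.det_neg_of_even_card heven, hU, ← hZ, ← hdet] at hd
  rw [fullDet, ← hd, mul_comm, mul_assoc, hUsq, mul_one]

end Diagram

end TwistedLink

theorem mainTheorem1 (D D' : TwistedLink.Diagram)
    (hD : D.NoFreeCircle) (hD' : D'.NoFreeCircle)
    (h : TwistedLink.Equivalent D D') :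
    ∃ m : ℤ, D'.Ztilde = TwistedLink.xPow m * D.Ztilde := by
  rw [hD.ztilde_eq_fullDet, hD'.ztilde_eq_fullDet]
  exact h.fullDet_eq
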